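/- Let $p$ be a prime and let $G$ be a $p$-group of maximal class, that is, a finite group of order $p^n$ and nilpotency class $n-1$ for some $n$. Then the Bogomolov multiplier $B_0(G)$ is finitely generated and $$\operatorname{rank} B_0(G)\le \frac{p-1}{2},$$ where the rank is the minimal number of generators. Here $B_0(G)$ is the kernel of the homomorphism $G\curlywedge G\to[G,G]$, $x\curlywedge y\mapsto [x,y]=x^{-1}y^{-1}xy$, where $G\curlywedge G$ is the group generated by the symbols $x\curlywedge y$ $(x,y\in G)$ subject to the relations $$xy\curlywedge z=(x^y\curlywedge z^y)(y\curlywedge z),\qquad x\curlywedge yz=(x\curlywedge z)(x^z\curlywedge y^z),\qquad a\curlywedge b=1,$$ for all $x,y,z\in G$ and all $a,b\in G$ with $[a,b]=1$, with $x^y=y^{-1}xy$. -/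

import Mathlib

/-- The relators of the curly exterior square of `G`, on the free group on the symbols
`x ⋏ y = (x, y)`; here `x ^ y` means `y⁻¹ * x * y`. -/
inductive CurlyRel (G : Type*) [Group G] : FreeGroup (G × G) → Prop
  /-- `xy ⋏ z = (x^y ⋏ z^y) (y ⋏ z)` -/
  | mul_left (x y z : G) : CurlyRel G
      (FreeGroup.of (x * y, z) *
        (FreeGroup.of (y⁻¹ * x * y, y⁻¹ * z * y) * FreeGroup.of (y, z))⁻¹)
  /-- `x ⋏ yz = (x ⋏ z) (x^z ⋏ y^z)` -/
  | mul_right (x y z : G) : CurlyRel G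
      (FreeGroup.of (x, y * z) *
        (FreeGroup.of (x, z) * FreeGroup.of (z⁻¹ * x * z, z⁻¹ * y * z))⁻¹)
  /-- `a ⋏ b = 1` whenever `a` and `b` commute -/
  | comm (a b : G) (h : Commute a b) : CurlyRel G (FreeGroup.of (a, b))

/-- The curly exterior square `G ⋏ G`. -/
abbrev CurlySquare (G : Type*) [Group G] : Type _ :=
  PresentedGroup {r : FreeGroup (G × G) | CurlyRel G r}

/-- The group commutator `[x, y] = x⁻¹ y⁻¹ x y`, as an element of the derived subgroup. -/
def curlyComm (G : Type*) [Group G] (g : G × G) : commutator G :=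
  ⟨g.1⁻¹ * g.2⁻¹ * g.1 * g.2, by
    have h := Subgroup.commutator_mem_commutator
      (Subgroup.mem_top (g.1⁻¹)) (Subgroup.mem_top (g.2⁻¹))
    simpa [commutatorElement_def, commutator_def] using h⟩

theorem curlyComm_rel (G : Type*) [Group G] :
    ∀ r ∈ {r : FreeGroup (G × G) | CurlyRel G r}, FreeGroup.lift (curlyComm G) r = 1 := by
  intro r hr
  cases hr with
  | mul_left x y z =>
    apply Subtype.ext
    simp [curlyComm, mul_assoc]
  | mul_right x y z =>
    apply Subtype.ext
    simp [curlyComm, mul_assoc]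
  | comm a b h =>
    apply Subtype.ext
    have h' : a * b = b * a := h
    simp [curlyComm, mul_assoc, h']

/-- The canonical homomorphism `G ⋏ G → [G, G]`, `x ⋏ y ↦ [x, y]`. -/
def curlyHom (G : Type*) [Group G] : CurlySquare G →* commutator G :=
  PresentedGroup.toGroup (curlyComm_rel G)

/-- The Bogomolov multiplier `B₀(G)`: the kernel of `G ⋏ G → [G, G]`. -/
abbrev BogomolovMultiplier (G : Type*) [Group G] : Subgroup (CurlySquare G) :=
  (curlyHom G).ker

/-- `G` is a `p`-group of maximal class: it has order `p ^ n` and nilpotency class `n - 1`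
for some `n`. -/
def IsPGroupOfMaximalClass (p : ℕ) (G : Type*) [Group G] : Prop :=
  ∃ n : ℕ, Nat.card G = p ^ n ∧ Group.IsNilpotent G ∧ Group.nilpotencyClass G + 1 = n

/-! Write γ_i for `lcs G i`, e_i for `lnc s t i`, and R_m for `cfil W m`, generated by γ_{m-1} ⋏ G
and a subgroup W of B₀(G). The map x ⋏ y ↦ [x, y] is a crossed module. Hence γ_i ⋏ γ_j ≤ R_{i+j},
and modulo R_{i+j+1} the symbol is bilinear on γ_i × γ_j and satisfies a Jacobi identity
(`cpr_jacobi`). If γ_n = 1 then R_n = W, so W = B₀(G) follows once B₀(G) ≤ R_l is pushed from l = 2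
up to n.

Let s, t generate G modulo γ_2 and let x generate γ_{l-1}/γ_l, l ≥ 3. Then R_l/R_{l+1} has exponent
p and is generated by x ⋏ s and x ⋏ t. If x ⋏ t ∈ R_{l+1}, the quotient is cyclic and is detected by
the commutator map, so B₀(G) drops to R_{l+1} (`ker_le_succ_of_cw_mem`). In general t can be chosen
with [x, t] ∈ γ_{l+1}, and one element of B₀(G) put into W forces x ⋏ t ∈ R_{l+1}
(`exists_step_element`). So a level costs at most one generator.

Most levels cost none. For even l, Jacobi gives t ⋏ e_{l-1} = (e_{l/2} ⋏ e_{l/2})^{±1} = 1 modulo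
R_{l+1} (`DegreeBelow.cw_mem_of_even`). For odd l > p, comparing y ⋏ s^p with y ⋏ (st)^p, both
trivial, isolates e_{l-1} ⋏ t (`cw_lnc_mem_of_lt`). Only odd l with 3 ≤ l ≤ p remain; there the same
pair s, t stays usable because [e_{l-1}, t] ∈ γ_{l+1} when l + 1 < n (`gc_lnc_mem_of_le`, and the
choice of t for l = 3). -/

/-- The commutator `[x, y] = x⁻¹ y⁻¹ x y`. -/
def gc {G : Type*} [Group G] (x y : G) : G := x⁻¹ * y⁻¹ * x * y

/-! ### The crossed module structure of the curly exterior square -/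

section CurlySquareBasics

variable {G : Type*} [Group G]

/-- The generator `x ⋏ y` of the curly exterior square. -/
def cw (x y : G) : CurlySquare G := PresentedGroup.of (x, y)

theorem cw_mul_left' (x y z : G) :
    cw (x * y) z = cw (y⁻¹ * x * y) (y⁻¹ * z * y) * cw y z :=
  PresentedGroup.mk_eq_mk_of_mul_inv_mem (CurlyRel.mul_left x y z)

theorem cw_mul_right' (x y z : G) :
    cw x (y * z) = cw x z * cw (z⁻¹ * x * z) (z⁻¹ * y * z) :=
  PresentedGroup.mk_eq_mk_of_mul_inv_mem (CurlyRel.mul_right x y z)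

theorem cw_of_commute {x y : G} (h : Commute x y) : cw x y = 1 :=
  PresentedGroup.one_of_mem (CurlyRel.comm x y h)

theorem curly_conj_rel (g : G) :
    ∀ r ∈ {r : FreeGroup (G × G) | CurlyRel G r},
      FreeGroup.lift (fun z : G × G => cw (g⁻¹ * z.1 * g) (g⁻¹ * z.2 * g)) r = 1 := by
  intro r hr
  cases hr with
  | mul_left x y z =>
    have := cw_mul_left' (g⁻¹ * x * g) (g⁻¹ * y * g) (g⁻¹ * z * g)
    simp only [map_mul, map_inv, FreeGroup.lift_apply_of, mul_inv_eq_one]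
    convert this using 2 <;> group
  | mul_right x y z =>
    have := cw_mul_right' (g⁻¹ * x * g) (g⁻¹ * y * g) (g⁻¹ * z * g)
    simp only [map_mul, map_inv, FreeGroup.lift_apply_of, mul_inv_eq_one]
    convert this using 2 <;> group
  | comm a b h =>
    have h' : Commute (g⁻¹ * a * g) (g⁻¹ * b * g) := by
      have := h.eq
      show _ * _ = _ * _
      calc _ = g⁻¹ * (a * b) * g := by group
        _ = g⁻¹ * (b * a) * g := by rw [this]
        _ = _ := by group
    simpa using cw_of_commute h'

/-- The conjugation action `q ↦ q ^ g` of `G` on its curly exterior square. -/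
def cact (g : G) : CurlySquare G →* CurlySquare G := PresentedGroup.toGroup (curly_conj_rel g)

/-- The homomorphism `G ⋏ G → G`, `x ⋏ y ↦ [x, y]`. -/
def ckap : CurlySquare G →* G := (commutator G).subtype.comp (curlyHom G)

theorem cact_cw (g x y : G) : cact g (cw x y) = cw (g⁻¹ * x * g) (g⁻¹ * y * g) :=
  PresentedGroup.toGroup.of _

theorem ckap_cw (x y : G) : ckap (cw x y) = gc x y := by
  show ((PresentedGroup.toGroup (curlyComm_rel G) (PresentedGroup.of (x, y)) : commutator G) : G)
    = _
  rw [PresentedGroup.toGroup.of]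
  rfl

theorem mem_ker_curlyHom_iff {q : CurlySquare G} : q ∈ BogomolovMultiplier G ↔ ckap q = 1 := by
  rw [MonoidHom.mem_ker]
  exact (OneMemClass.coe_eq_one).symm

theorem curly_hom_ext {H : Type*} [Group H] {f g : CurlySquare G →* H}
    (h : ∀ x y, f (cw x y) = g (cw x y)) : f = g :=
  PresentedGroup.ext fun z => h z.1 z.2

theorem closure_cw : Subgroup.closure {q : CurlySquare G | ∃ x y, q = cw x y} = ⊤ := by
  rw [← PresentedGroup.closure_range_of]
  congr 1
  ext q
  constructor
  · rintro ⟨x, y, rfl⟩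
    exact ⟨(x, y), rfl⟩
  · rintro ⟨⟨x, y⟩, rfl⟩
    exact ⟨x, y, rfl⟩

theorem cact_mul (g h : G) (q : CurlySquare G) : cact (g * h) q = cact h (cact g q) := by
  have : cact (g * h) = (cact h).comp (cact g) := curly_hom_ext fun x y => by
    simp only [MonoidHom.comp_apply, cact_cw]
    congr 1 <;> group
  rw [this]
  rfl

theorem cact_one (q : CurlySquare G) : cact (1 : G) q = q := by
  have : cact (1 : G) = MonoidHom.id _ := curly_hom_ext fun x y => by
    simp [cact_cw]
  rw [this]
  rfl

theorem cact_inv_cact (g : G) (q : CurlySquare G) : cact g⁻¹ (cact g q) = q := by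
  rw [← cact_mul, mul_inv_cancel, cact_one]

theorem cact_cact_inv (g : G) (q : CurlySquare G) : cact g (cact g⁻¹ q) = q := by
  rw [← cact_mul, inv_mul_cancel, cact_one]

theorem cw_mul_left (x y z : G) : cw (x * y) z = cact y (cw x z) * cw y z := by
  rw [cw_mul_left', cact_cw]

theorem cw_mul_right (x y z : G) : cw x (y * z) = cw x z * cact z (cw x y) := by
  rw [cw_mul_right', cact_cw]

theorem cw_self (x : G) : cw x x = 1 := cw_of_commute (Commute.refl x)

theorem cw_one_left (x : G) : cw 1 x = 1 := cw_of_commute (Commute.one_left x)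

theorem cw_one_right (x : G) : cw x 1 = 1 := cw_of_commute (Commute.one_right x)

theorem cw_mul_cw_swap (x y : G) : cw x y * cw y x = 1 := by
  have h := cw_self (x * y)
  rw [cw_mul_left, cw_mul_right, cw_mul_right, cw_self, cw_self, map_one, mul_one, one_mul,
    ← map_mul] at h
  have h2 := congrArg (cact y⁻¹) h
  rwa [cact_inv_cact, map_one] at h2

theorem cw_swap (x y : G) : cw y x = (cw x y)⁻¹ :=
  eq_inv_of_mul_eq_one_right (cw_mul_cw_swap x y)

theorem cw_inv_left (x z : G) : cw x⁻¹ z = (cact x⁻¹ (cw x z))⁻¹ := by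
  have h := cw_mul_left x x⁻¹ z
  rw [mul_inv_cancel, cw_one_left] at h
  exact eq_inv_of_mul_eq_one_right h.symm

theorem cw_conj_cact (y w : G) (q : CurlySquare G) :
    (cw y w)⁻¹ * q * cw y w = cact (gc y w) q := by
  have key : ∀ r : CurlySquare G,
      (cw y w)⁻¹ * cact (w * y) r * cw y w = cact (y * w) r := by
    intro r
    -- On generators this compares the two expansions of xy ⋏ zw, splitting the left or the right
    -- argument first.
    have : (MulAut.conj (cw y w)⁻¹).toMonoidHom.comp (cact (w * y)) = cact (y * w) :=
      curly_hom_ext fun x z => by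
        have h1 : cw (x * y) (z * w) =
            cact y (cw x w) * cact (w * y) (cw x z) * (cw y w * cact w (cw y z)) := by
          rw [cw_mul_left, cw_mul_right x, cw_mul_right y, map_mul, cact_mul]
        have h2 : cw (x * y) (z * w) =
            cact y (cw x w) * cw y w * (cact (y * w) (cw x z) * cact w (cw y z)) := by
          rw [cw_mul_right, cw_mul_left, cw_mul_left, map_mul, cact_mul]
        have h3 := h1.symm.trans h2
        simp only [mul_assoc, mul_left_cancel_iff] at h3
        simp only [← mul_assoc, mul_right_cancel_iff] at h3
        simp only [MonoidHom.comp_apply, MulEquiv.toMonoidHom_eq_coe, MonoidHom.coe_coe,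
          MulAut.conj_apply, inv_inv]
        rw [mul_assoc, h3, inv_mul_cancel_left]
    have h := DFunLike.congr_fun this r
    simpa using h
  have h := key (cact (w * y)⁻¹ q)
  rw [cact_cact_inv, ← cact_mul] at h
  rw [h]
  congr 2
  simp only [gc]
  group

/-- The Peiffer identity: inner automorphisms of G ⋏ G act through commutators in G. Together with
`inv_mul_cact` it turns commutators in G ⋏ G into single symbols. -/
theorem conj_cact (r q : CurlySquare G) : r⁻¹ * q * r = cact (ckap r) q := by
  have hr : r ∈ Subgroup.closure {q : CurlySquare G | ∃ x y, q = cw x y} := by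
    rw [closure_cw]; trivial
  induction hr using Subgroup.closure_induction generalizing q with
  | mem r h =>
    obtain ⟨x, y, rfl⟩ := h
    rw [ckap_cw, cw_conj_cact]
  | one => simp [cact_one]
  | mul a b _ _ ha hb =>
    rw [map_mul, cact_mul, ← ha, ← hb]
    group
  | inv a _ ha =>
    have h := ha (cact (ckap a)⁻¹ q)
    rw [cact_cact_inv] at h
    rw [map_inv]
    conv_lhs => rw [← h]
    group

theorem cw_gc_left (x y g : G) : cw (gc x y) g = (cw x y)⁻¹ * cact g (cw x y) := by
  have e : gc x y = x⁻¹ * (y⁻¹ * x * y) := by simp only [gc]; group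
  have e2 : cact (y⁻¹ * x * y) (cw x⁻¹ g) = (cw x y)⁻¹ * (cw x g)⁻¹ * cw x y := by
    rw [cw_inv_left, map_inv, ← cact_mul, ← e, ← ckap_cw, ← conj_cact]
    group
  have e3 : cw (y⁻¹ * x * y) g = (cw x y)⁻¹ * cw x g * cact g (cw x y) := by
    have h1 : cw (y⁻¹ * x * y) g = cact y (cw x (y * g * y⁻¹)) := by
      rw [cact_cw]
      congr 1
      group
    have h2 := cw_mul_right x (y * g * y⁻¹) y
    rw [show y * g * y⁻¹ * y = y * g by group, cw_mul_right] at h2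
    rw [h1, mul_assoc (cw x y)⁻¹, h2, inv_mul_cancel_left]
  rw [e, cw_mul_left, e2, e3]
  group

theorem inv_mul_cact (q : CurlySquare G) (g : G) : q⁻¹ * cact g q = cw (ckap q) g := by
  have hr : q ∈ Subgroup.closure {q : CurlySquare G | ∃ x y, q = cw x y} := by
    rw [closure_cw]; trivial
  induction hr using Subgroup.closure_induction with
  | mem r h =>
    obtain ⟨x, y, rfl⟩ := h
    rw [ckap_cw, cw_gc_left]
  | one => simp [cw_one_left]
  | mul a b _ _ ha hb =>
    rw [map_mul, map_mul, cw_mul_left, ← ha, ← hb, ← conj_cact]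
    group
  | inv a _ ha =>
    rw [map_inv (ckap (G := G)), cw_inv_left, ← ha, ← map_inv (ckap (G := G)), ← conj_cact, map_inv (cact g)]
    group

theorem cact_eq_mul (q : CurlySquare G) (g : G) : cact g q = q * cw (ckap q) g := by
  rw [← inv_mul_cact]
  group

theorem cact_of_ckap_eq_one {q : CurlySquare G} (h : ckap q = 1) (g : G) : cact g q = q := by
  rw [cact_eq_mul, h, cw_one_left, mul_one]

theorem commutator_eq_cw (q r : CurlySquare G) : gc q r = cw (ckap q) (ckap r) := by
  rw [← inv_mul_cact, ← conj_cact]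
  simp only [gc]
  group

end CurlySquareBasics

/-! ### The filtration of G ⋏ G and its graded bilinear structure -/

section Filtration

variable {G : Type*} [Group G]

theorem gc_inv (x y : G) : (gc x y)⁻¹ = gc y x := by
  simp only [gc]; group

theorem gc_mul_left (x y z : G) : gc (x * y) z = y⁻¹ * gc x z * y * gc y z := by
  simp only [gc]; group

theorem gc_eq_one_iff {x y : G} : gc x y = 1 ↔ Commute x y := by
  constructor
  · intro h
    have : x * y = y * x * gc x y := by simp only [gc]; group
    rw [h, mul_one] at this
    exact this
  · intro h
    have : gc x y = (y * x)⁻¹ * (x * y) := by simp only [gc]; group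
    rw [this, h.eq, inv_mul_cancel]

variable (G) in
/-- The lower central series of `G`, indexed so that `lcs G 1 = G`. -/
def lcs (i : ℕ) : Subgroup G := (⊤ : Subgroup G).lowerCentralSeries (i - 1)

instance lcs_characteristic (i : ℕ) : (lcs G i).Characteristic := by
  unfold lcs; infer_instance

theorem mem_lcs_one (x : G) : x ∈ lcs G 1 := Subgroup.mem_top x

theorem lcs_antitone : Antitone (lcs G) := fun _ _ h =>
  Subgroup.lowerCentralSeries_antitone _ (Nat.sub_le_sub_right h 1)

theorem gc_mem_lcs {i : ℕ} {x : G} (hx : x ∈ lcs G i) (g : G) : gc x g ∈ lcs G (i + 1) := by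
  rcases Nat.eq_zero_or_pos i with rfl | hi
  · exact mem_lcs_one _
  · have h : x⁻¹ * g⁻¹ * x⁻¹⁻¹ * g⁻¹⁻¹ ∈ (⊤ : Subgroup G).lowerCentralSeries (i - 1 + 1) :=
      Subgroup.commutator_mem_commutator (inv_mem hx) (Subgroup.mem_top g⁻¹)
    rw [inv_inv, inv_inv] at h
    rwa [lcs, show i + 1 - 1 = i - 1 + 1 by omega]

theorem lcs_succ_le {i : ℕ} (hi : 1 ≤ i) {H : Subgroup G}
    (h : ∀ x ∈ lcs G i, ∀ g, gc x g ∈ H) : lcs G (i + 1) ≤ H := by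
  rw [lcs, show i + 1 - 1 = i - 1 + 1 by omega, Subgroup.lowerCentralSeries_succ,
    Subgroup.commutator_le]
  intro x hx g _
  have := h x⁻¹ (inv_mem hx) g⁻¹
  simpa [gc, commutatorElement_def] using this

theorem conj_mem_lcs {i : ℕ} {x : G} (hx : x ∈ lcs G i) (g : G) : g⁻¹ * x * g ∈ lcs G i := by
  have := (inferInstance : (lcs G i).Normal).conj_mem x hx g⁻¹
  simpa using this

/-- The filtration of `G ⋏ G` by the subgroups generated by `γ_{m-1}(G) ⋏ G` and `W`. -/
def cfil (W : Subgroup (BogomolovMultiplier G)) (m : ℕ) : Subgroup (CurlySquare G) :=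
  Subgroup.closure {q | ∃ x ∈ lcs G (m - 1), ∃ g, q = cw x g} ⊔
    W.map (BogomolovMultiplier G).subtype

variable {W : Subgroup (BogomolovMultiplier G)}

theorem cw_mem_cfil {i : ℕ} {x : G} (hx : x ∈ lcs G i) (g : G) : cw x g ∈ cfil W (i + 1) :=
  Subgroup.mem_sup_left (Subgroup.subset_closure ⟨x, hx, g, rfl⟩)

theorem mem_cfil_of_mem {m : ℕ} {w : BogomolovMultiplier G} (hw : w ∈ W) :
    (w : CurlySquare G) ∈ cfil W m :=
  Subgroup.mem_sup_right (Subgroup.mem_map_of_mem _ hw)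

theorem ckap_coe (w : BogomolovMultiplier G) : ckap (w : CurlySquare G) = 1 :=
  mem_ker_curlyHom_iff.1 w.2

theorem cfil_le {m : ℕ} {H : Subgroup (CurlySquare G)}
    (h1 : ∀ x ∈ lcs G (m - 1), ∀ g, cw x g ∈ H) (h2 : ∀ w ∈ W, (w : CurlySquare G) ∈ H) :
    cfil W m ≤ H := by
  refine sup_le ?_ ?_
  · rw [Subgroup.closure_le]
    rintro _ ⟨x, hx, g, rfl⟩
    exact h1 x hx g
  · rintro _ ⟨w, hw, rfl⟩
    exact h2 w hw

theorem cfil_antitone : Antitone (cfil W) := by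
  intro a b hab
  refine cfil_le (fun x hx g => ?_) fun w hw => mem_cfil_of_mem hw
  exact Subgroup.mem_sup_left
    (Subgroup.subset_closure ⟨x, lcs_antitone (Nat.sub_le_sub_right hab 1) hx, g, rfl⟩)

theorem cfil_mono {W' : Subgroup (BogomolovMultiplier G)} (h : W ≤ W') (m : ℕ) :
    cfil W m ≤ cfil W' m :=
  sup_le_sup le_rfl (Subgroup.map_mono h)

theorem ckap_mem_lcs {m : ℕ} {q : CurlySquare G} (hq : q ∈ cfil W m) : ckap q ∈ lcs G m := by
  suffices h : cfil W m ≤ (lcs G m).comap ckap from h hq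
  refine cfil_le (fun x hx g => ?_) fun w _ => ?_
  · rw [Subgroup.mem_comap, ckap_cw]
    exact lcs_antitone (by omega) (gc_mem_lcs hx g)
  · rw [Subgroup.mem_comap, ckap_coe]
    exact one_mem _

/-- The shift m - 1 in `cfil` makes the commutator map send R_m onto γ_m for m ≥ 2. -/
theorem exists_mem_cfil_ckap_eq {m : ℕ} (hm : 2 ≤ m) {y : G} (hy : y ∈ lcs G m) :
    ∃ q ∈ cfil W m, ckap q = y := by
  suffices h : lcs G m ≤ (cfil W m).map ckap from h hy
  obtain ⟨i, rfl⟩ : ∃ i, m = i + 1 := ⟨m - 1, by omega⟩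
  refine lcs_succ_le (by omega) fun x hx g => ?_
  exact ⟨cw x g, cw_mem_cfil hx g, ckap_cw x g⟩

theorem cact_mem_cfil {m : ℕ} {q : CurlySquare G} (hq : q ∈ cfil W m) (g : G) :
    cact g q ∈ cfil W m := by
  suffices h : cfil W m ≤ (cfil W m).comap (cact g) from h hq
  refine cfil_le (fun x hx y => ?_) fun w hw => ?_
  · rw [Subgroup.mem_comap, cact_cw]
    exact Subgroup.mem_sup_left (Subgroup.subset_closure ⟨_, conj_mem_lcs hx g, _, rfl⟩)
  · rw [Subgroup.mem_comap, cact_of_ckap_eq_one (ckap_coe w)]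
    exact mem_cfil_of_mem hw

instance cfil_normal (m : ℕ) : (cfil W m).Normal := by
  refine ⟨fun q hq r => ?_⟩
  have h := conj_cact r⁻¹ q
  rw [inv_inv] at h
  rw [h]
  exact cact_mem_cfil hq _

theorem cfil_eq_top {m : ℕ} (hm : m ≤ 2) : cfil W m = ⊤ := by
  rw [eq_top_iff, ← closure_cw, Subgroup.closure_le]
  rintro _ ⟨x, y, rfl⟩
  exact cfil_antitone hm (cw_mem_cfil (mem_lcs_one x) y)

theorem inv_mul_cact_mem {m : ℕ} {q : CurlySquare G} (hq : q ∈ cfil W m) (g : G) :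
    q⁻¹ * cact g q ∈ cfil W (m + 1) := by
  rw [inv_mul_cact]
  exact cw_mem_cfil (ckap_mem_lcs hq) g

theorem gc_mem_cfil_succ {m : ℕ} {q : CurlySquare G} (hq : q ∈ cfil W m) (r : CurlySquare G) :
    gc q r ∈ cfil W (m + 1) := by
  rw [commutator_eq_cw]
  exact cw_mem_cfil (ckap_mem_lcs hq) _

/-- The elements `z` with `x ⋏ z ∈ R` for all `x ∈ S`, for a conjugation invariant `R`. -/
def cwAnnihilator (W : Subgroup (BogomolovMultiplier G)) (S : Set G) (m : ℕ) : Subgroup G where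
  carrier := {z | ∀ x ∈ S, cw x z ∈ cfil W m}
  one_mem' x _ := by rw [cw_one_right]; exact one_mem _
  mul_mem' {a b} ha hb x hx := by
    rw [cw_mul_right]
    exact mul_mem (hb x hx) (cact_mem_cfil (ha x hx) b)
  inv_mem' {a} ha x hx := by
    rw [cw_swap, cw_inv_left, inv_inv, cw_swap, map_inv]
    exact inv_mem (cact_mem_cfil (ha x hx) _)

/-- A three subgroups argument: the actions of gy and yg on q differ by that of [y, g], and both are
expanded modulo R_{i+j+1}. -/
theorem cact_gc_mem {i j : ℕ} {r : CurlySquare G} {y : G} (g : G)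
    (hy : ∀ r ∈ cfil W i, r⁻¹ * cact y r ∈ cfil W (i + j))
    (hy' : ∀ r ∈ cfil W (i + 1), r⁻¹ * cact y r ∈ cfil W (i + j + 1))
    (hr : r ∈ cfil W i) : r⁻¹ * cact (gc y g) r ∈ cfil W (i + j + 1) := by
  set q := cact (g * y)⁻¹ r with hqr
  have hq : q ∈ cfil W i := cact_mem_cfil hr _
  have hr' : r = cact (g * y) q := by rw [hqr, cact_cact_inv]
  obtain ⟨a, ha, hqa⟩ : ∃ a ∈ cfil W (i + j), cact y q = q * a := ⟨_, hy q hq, by group⟩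
  obtain ⟨b, hb, hqb⟩ : ∃ b ∈ cfil W (i + 1), cact g q = q * b :=
    ⟨_, inv_mul_cact_mem hq g, by group⟩
  obtain ⟨c, hc, hac⟩ : ∃ c ∈ cfil W (i + j + 1), cact g a = a * c :=
    ⟨_, inv_mul_cact_mem ha g, by group⟩
  obtain ⟨d, hd, hbd⟩ : ∃ d ∈ cfil W (i + j + 1), cact y b = b * d := ⟨_, hy' b hb, by group⟩
  have e1 : r = q * a * (b * d) := by rw [hr', cact_mul, hqb, map_mul, hqa, hbd]
  have e2 : cact (gc y g) r = q * b * (a * c) := by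
    rw [hr', ← cact_mul, show g * y * gc y g = y * g by simp only [gc]; group, cact_mul, hqa,
      map_mul, hqb, hac]
  have e3 : r⁻¹ * cact (gc y g) r = d⁻¹ * (gc a b)⁻¹ * c := by
    rw [e2, e1]
    simp only [gc]
    group
  rw [e3]
  exact mul_mem (mul_mem (inv_mem hd) (inv_mem (gc_mem_cfil_succ ha b))) hc

theorem cw_mem_cfil_add {i j : ℕ} (hi : 1 ≤ i) (hj : 1 ≤ j) {x y : G} (hx : x ∈ lcs G i)
    (hy : y ∈ lcs G j) : cw x y ∈ cfil W (i + j) := by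
  obtain rfl | hi : i = 1 ∨ 2 ≤ i := by omega
  · rw [cw_swap, add_comm]
    exact inv_mem (cw_mem_cfil hy x)
  · induction j, hj using Nat.le_induction generalizing i x y with
    | base => exact cw_mem_cfil hx y
    | succ j hj ih =>
      suffices h : lcs G (j + 1) ≤ cwAnnihilator W (lcs G i) (i + j + 1) from h hy x hx
      refine lcs_succ_le hj fun y hy g x hx => ?_
      -- Lifting x to r turns x ⋏ z into r⁻¹ r^z, so that only the action has to be controlled; this
      -- needs i ≥ 2.
      obtain ⟨r, hr, rfl⟩ := exists_mem_cfil_ckap_eq (W := W) hi hx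
      rw [← inv_mul_cact]
      refine cact_gc_mem g (fun r hr => ?_) (fun r hr => ?_) hr
      · rw [inv_mul_cact]
        exact ih (by omega) (ckap_mem_lcs hr) hy (by omega)
      · rw [inv_mul_cact, show i + j + 1 = i + 1 + j by omega]
        exact ih (by omega) (ckap_mem_lcs hr) hy (by omega)

theorem gc_mem_lcs_add {i j : ℕ} (hi : 1 ≤ i) (hj : 1 ≤ j) {x y : G} (hx : x ∈ lcs G i)
    (hy : y ∈ lcs G j) : gc x y ∈ lcs G (i + j) := by
  rw [← ckap_cw]
  exact ckap_mem_lcs (cw_mem_cfil_add (W := ⊥) hi hj hx hy)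

theorem gc_mem_cfil_add {i j : ℕ} (hi : 1 ≤ i) (hj : 1 ≤ j) {q r : CurlySquare G}
    (hq : q ∈ cfil W i) (hr : r ∈ cfil W j) : gc q r ∈ cfil W (i + j) := by
  rw [commutator_eq_cw]
  exact cw_mem_cfil_add hi hj (ckap_mem_lcs hq) (ckap_mem_lcs hr)

/-- The projection of `G ⋏ G` modulo `cfil W (m + 1)`. -/
def cpr (W : Subgroup (BogomolovMultiplier G)) (m : ℕ) :
    CurlySquare G →* CurlySquare G ⧸ cfil W (m + 1) :=
  QuotientGroup.mk' _

theorem cpr_eq_one_iff {m : ℕ} {q : CurlySquare G} : cpr W m q = 1 ↔ q ∈ cfil W (m + 1) :=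
  QuotientGroup.eq_one_iff q

theorem cpr_eq_iff {m : ℕ} {q r : CurlySquare G} : cpr W m q = cpr W m r ↔
    q⁻¹ * r ∈ cfil W (m + 1) :=
  QuotientGroup.eq

theorem cpr_cact {m : ℕ} {q : CurlySquare G} (hq : q ∈ cfil W m) (g : G) :
    cpr W m (cact g q) = cpr W m q :=
  (cpr_eq_iff.2 (inv_mul_cact_mem hq g)).symm

theorem cpr_commute {m : ℕ} {q : CurlySquare G} (hq : q ∈ cfil W m) (r : CurlySquare G) :
    Commute (cpr W m q) (cpr W m r) := by
  rw [← gc_eq_one_iff]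
  have : gc (cpr W m q) (cpr W m r) = cpr W m (gc q r) := by simp only [gc, map_mul, map_inv]
  rw [this, cpr_eq_one_iff]
  exact gc_mem_cfil_succ hq r

section Bilinear

variable {i j m : ℕ}

theorem cpr_cw_mul_left (hi : 1 ≤ i) (hj : 1 ≤ j) (hm : m ≤ i + j) {x y z : G}
    (hx : x ∈ lcs G i) (hz : z ∈ lcs G j) :
    cpr W m (cw (x * y) z) = cpr W m (cw x z) * cpr W m (cw y z) := by
  rw [cw_mul_left, map_mul, cpr_cact (cfil_antitone hm (cw_mem_cfil_add hi hj hx hz))]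

theorem cpr_cw_mul_right (hi : 1 ≤ i) (hj : 1 ≤ j) (hm : m ≤ i + j) {x y z : G}
    (hx : x ∈ lcs G i) (hy : y ∈ lcs G j) :
    cpr W m (cw x (y * z)) = cpr W m (cw x y) * cpr W m (cw x z) := by
  have h := cfil_antitone (W := W) hm (cw_mem_cfil_add hi hj hx hy)
  rw [cw_mul_right, map_mul, cpr_cact h, (cpr_commute h _).eq]

/-- `x ↦ x ⋏ z` as a homomorphism on `γ_i(G)`, for `z ∈ γ_j(G)`. -/
def cprLeft (W : Subgroup (BogomolovMultiplier G)) (hi : 1 ≤ i) (hj : 1 ≤ j) (hm : m ≤ i + j)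
    (z : lcs G j) : lcs G i →* CurlySquare G ⧸ cfil W (m + 1) where
  toFun x := cpr W m (cw x z)
  map_one' := by simp [cw_one_left]
  map_mul' x y := cpr_cw_mul_left hi hj hm x.2 z.2

theorem cpr_cw_zpow_left (hi : 1 ≤ i) (hj : 1 ≤ j) (hm : m ≤ i + j) {x z : G}
    (hx : x ∈ lcs G i) (hz : z ∈ lcs G j) (k : ℤ) :
    cpr W m (cw (x ^ k) z) = cpr W m (cw x z) ^ k :=
  map_zpow (cprLeft W hi hj hm ⟨z, hz⟩) ⟨x, hx⟩ k

theorem cpr_cw_swap (x y : G) : cpr W m (cw y x) = (cpr W m (cw x y))⁻¹ := by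
  rw [cw_swap, map_inv]

theorem cpr_cw_zpow_right (hi : 1 ≤ i) (hj : 1 ≤ j) (hm : m ≤ i + j) {x z : G}
    (hx : x ∈ lcs G i) (hz : z ∈ lcs G j) (k : ℤ) :
    cpr W m (cw x (z ^ k)) = cpr W m (cw x z) ^ k := by
  rw [cpr_cw_swap, cpr_cw_zpow_left hj hi (by omega) hz hx, cpr_cw_swap, inv_zpow, inv_inv]

theorem cpr_cw_eq_one (hi : 1 ≤ i) (hj : 1 ≤ j) (hm : m + 1 ≤ i + j) {x y : G}
    (hx : x ∈ lcs G i) (hy : y ∈ lcs G j) : cpr W m (cw x y) = 1 :=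
  cpr_eq_one_iff.2 (cfil_antitone hm (cw_mem_cfil_add hi hj hx hy))

/-- The value of `x ⋏ z` only depends on the class of `x` in `γ_i / γ_{i+1}`. -/
theorem cpr_cw_congr_left (hi : 1 ≤ i) (hj : 1 ≤ j) (hm : m ≤ i + j) {x y z : G}
    (hx : x ∈ lcs G i) (hxy : x⁻¹ * y ∈ lcs G (i + 1)) (hz : z ∈ lcs G j) :
    cpr W m (cw y z) = cpr W m (cw x z) := by
  have h := cpr_cw_mul_left (W := W) hi hj hm (y := x⁻¹ * y) hx hz
  rwa [mul_inv_cancel_left, cpr_cw_eq_one (by omega) hj (by omega) hxy hz, mul_one] at h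

theorem cpr_cw_congr_right (hi : 1 ≤ i) (hj : 1 ≤ j) (hm : m ≤ i + j) {x y z : G}
    (hx : x ∈ lcs G i) (hxy : x⁻¹ * y ∈ lcs G (i + 1)) (hz : z ∈ lcs G j) :
    cpr W m (cw z y) = cpr W m (cw z x) := by
  rw [cpr_cw_swap, cpr_cw_congr_left hi hj hm hx hxy hz, cpr_cw_swap x z]

/-- Expand xy ⋏ z directly and as yx[x, y] ⋏ z; modulo R_{i+j+k+1} everything except the three
triple terms cancels. -/
theorem cpr_jacobi {k : ℕ} (hi : 1 ≤ i) (hj : 1 ≤ j) (hk : 1 ≤ k) (hm : m = i + j + k) {x y z : G}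
    (hx : x ∈ lcs G i) (hy : y ∈ lcs G j) (hz : z ∈ lcs G k) :
    cpr W m (cw (gc x z) y) = cpr W m (cw (gc y z) x) * cpr W m (cw (gc x y) z) := by
  subst hm
  have hxz := cw_mem_cfil_add (W := W) hi hk hx hz
  have hyz := cw_mem_cfil_add (W := W) hj hk hy hz
  have hxy := cw_mem_cfil_add (W := W) hi hj hx hy
  have h1 : cw (x * y) z = cw x z * cw (gc x z) y * cw y z := by
    rw [cw_mul_left, cact_eq_mul, ckap_cw]
  have h2 : cw (x * y) z = cact (gc x y) (cw y z * cw (gc y z) x * cw x z) * cw (gc x y) z := by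
    rw [show x * y = y * x * gc x y by simp only [gc]; group, cw_mul_left, cw_mul_left,
      cact_eq_mul (cw y z) x, ckap_cw]
  -- Since [x, y] ∈ γ_{i+j}, it moves an element of R_a only by an element of R_{a+i+j}.
  have hact : ∀ {a : ℕ} {q : CurlySquare G}, q ∈ cfil W a → i + j + k + 1 ≤ a + (i + j) →
      1 ≤ a → cpr W (i + j + k) (cact (gc x y) q) = cpr W (i + j + k) q := by
    intro a q hq ha ha1
    rw [cact_eq_mul, map_mul, cpr_cw_eq_one ha1 (j := i + j) (by omega) ha (ckap_mem_lcs hq)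
      (gc_mem_lcs_add hi hj hx hy), mul_one]
  have hA : cw (gc x z) y ∈ cfil W (i + j + k) := by
    have := cw_mem_cfil_add (W := W) (i := i + k) (by omega) hj (gc_mem_lcs_add hi hk hx hz) hy
    rwa [show i + j + k = i + k + j by omega]
  have hB : cw (gc y z) x ∈ cfil W (i + j + k) := by
    have := cw_mem_cfil_add (W := W) (i := j + k) (by omega) hi (gc_mem_lcs_add hj hk hy hz) hx
    rwa [show i + j + k = j + k + i by omega]
  have hcomm : Commute (cpr W (i + j + k) (cw x z)) (cpr W (i + j + k) (cw y z)) := by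
    rw [← gc_eq_one_iff]
    have : gc (cpr W (i + j + k) (cw x z)) (cpr W (i + j + k) (cw y z)) =
      cpr W (i + j + k) (gc (cw x z) (cw y z)) := by simp only [gc, map_mul, map_inv]
    rw [this, cpr_eq_one_iff]
    exact cfil_antitone (by omega) (gc_mem_cfil_add (by omega) (by omega) hxz hyz)
  have h3 := congrArg (cpr W (i + j + k)) (h1.symm.trans h2)
  simp only [map_mul] at h3
  rw [hact hxz (by omega) (by omega), hact hyz (by omega) (by omega),
    hact hB (by omega) (by omega)] at h3
  have cA := cpr_commute (W := W) hA
  have cB := cpr_commute (W := W) hB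
  have h4 : cpr W (i + j + k) (cw x z) * cpr W (i + j + k) (cw y z) *
        cpr W (i + j + k) (cw (gc x z) y) =
      cpr W (i + j + k) (cw x z) * cpr W (i + j + k) (cw y z) *
        (cpr W (i + j + k) (cw (gc y z) x) * cpr W (i + j + k) (cw (gc x y) z)) := by
    rw [mul_assoc, ← (cA (cw y z)).eq, ← mul_assoc, h3, hcomm.eq, mul_assoc (cpr _ _ (cw y z)),
      (cB (cw x z)).eq]
    simp only [mul_assoc]
  exact mul_left_cancel h4

end Bilinear

end Filtration

/-! ### Polynomial sequences in groups with an N-series -/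

section PolynomialSequences

variable {B : Type*} [Group B]

/-- The forward difference of a sequence in a group. -/
def sdiff1 (g : ℕ → B) : ℕ → B := fun n => (g n)⁻¹ * g (n + 1)

/-- Sequences whose `i`-th differences lie in `X (k + i)` for `i ≤ d`. -/
def PolySeq (X : ℕ → Subgroup B) : ℕ → ℕ → (ℕ → B) → Prop
  | 0, k, g => ∀ n, g n ∈ X k
  | d + 1, k, g => (∀ n, g n ∈ X k) ∧ PolySeq X d (k + 1) (sdiff1 g)

variable {X : ℕ → Subgroup B}

theorem PolySeq.mem {d k : ℕ} {g : ℕ → B} (h : PolySeq X d k g) (n : ℕ) : g n ∈ X k := by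
  cases d with
  | zero => exact h n
  | succ d => exact h.1 n

theorem PolySeq.of_succ {d k : ℕ} {g : ℕ → B} (h : PolySeq X (d + 1) k g) : PolySeq X d k g := by
  induction d generalizing k g with
  | zero => exact h.1
  | succ d ih => exact ⟨h.1, ih h.2⟩

theorem PolySeq.mono (hX : Antitone X) {d j k : ℕ} (hjk : j ≤ k) {g : ℕ → B}
    (h : PolySeq X d k g) : PolySeq X d j g := by
  induction d generalizing j k g with
  | zero => exact fun n => hX hjk (h n)
  | succ d ih => exact ⟨fun n => hX hjk (h.1 n), ih (by omega) h.2⟩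

theorem PolySeq.one {d k : ℕ} : PolySeq X d k (fun _ => 1) := by
  induction d generalizing k with
  | zero => exact fun n => one_mem _
  | succ d ih =>
    refine ⟨fun n => one_mem _, ?_⟩
    have : sdiff1 (fun _ : ℕ => (1 : B)) = fun _ => 1 := by
      funext n
      simp [sdiff1]
    rw [this]
    exact ih

/-- The closure properties of polynomial sequences with respect to an `N`-series. -/
theorem polySeq_closure (hX : Antitone X)
    (hc : ∀ i j, ∀ a ∈ X i, ∀ b ∈ X j, gc a b ∈ X (i + j)) (d : ℕ) :
    (∀ k g h, PolySeq X d k g → PolySeq X d k h → PolySeq X d k (fun n => g n * h n)) ∧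
    (∀ k g, PolySeq X d k g → PolySeq X d k (fun n => (g n)⁻¹)) ∧
    (∀ j k g h, PolySeq X d j g → PolySeq X d k h →
      PolySeq X d (j + k) (fun n => gc (g n) (h n))) := by
  induction d with
  | zero =>
    exact ⟨fun k g h hg hh n => mul_mem (hg n) (hh n), fun k g hg n => inv_mem (hg n),
      fun j k g h hg hh n => hc _ _ _ (hg n) _ (hh n)⟩
  | succ d ih =>
    obtain ⟨M, I, C⟩ := ih
    have conj : ∀ j k g h, PolySeq X d j g → PolySeq X d k h →
        PolySeq X d j (fun n => (h n)⁻¹ * g n * h n) := by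
      intro j k g h hg hh
      have := M j _ _ hg ((C j k g h hg hh).mono hX (by omega))
      convert this using 2
      simp only [gc]
      group
    refine ⟨fun k g h hg hh => ⟨fun n => mul_mem (hg.1 n) (hh.1 n), ?_⟩,
      fun k g hg => ⟨fun n => inv_mem (hg.1 n), ?_⟩,
      fun j k g h hg hh => ⟨fun n => hc _ _ _ (hg.1 n) _ (hh.1 n), ?_⟩⟩
    · have := M _ _ _ (conj _ _ _ _ hg.2 hh.of_succ) hh.2
      convert this using 2
      simp only [sdiff1]
      group
    · have := conj _ _ _ _ (I _ _ hg.2) (I _ _ hg.of_succ)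
      convert this using 2
      simp only [sdiff1]
      group
    -- With a = Δg and b = Δh, the difference of [g, h] is [ga, b]^{[g,h]} · [[g, h], ab] · [a,
    -- h]^b; these are `t1`, `t2`, `t3`.
    · have ga := M j _ _ hg.of_succ (hg.2.mono hX (by omega))
      have t1 := conj _ _ _ _ (C j (k + 1) _ _ ga hh.2) (C j k _ _ hg.of_succ hh.of_succ)
      have ab := M 1 _ _ (hg.2.mono hX (by omega)) (hh.2.mono hX (by omega))
      have t2 := C (j + k) 1 _ _ (C j k _ _ hg.of_succ hh.of_succ) ab
      have t3 := conj _ _ _ _ (C (j + 1) k _ _ hg.2 hh.of_succ) hh.2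
      have := M (j + k + 1) _ _ (M (j + k + 1) _ _ t1 t2) (t3.mono hX (by omega))
      convert this using 2
      simp only [sdiff1, gc]
      group

theorem sdiff1_mul (g h : ℕ → B) :
    sdiff1 (fun n => g n * h n) = fun n => sdiff1 g n * (gc (sdiff1 g n) (h n) * sdiff1 h n) := by
  funext n
  simp only [sdiff1, gc]
  group

theorem PolySeq.iterate {d k : ℕ} {g : ℕ → B} (h : PolySeq X d k g) {i : ℕ} (hi : i ≤ d) :
    PolySeq X (d - i) (k + i) (sdiff1^[i] g) := by
  induction i generalizing d k g with
  | zero => exact h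
  | succ i ih =>
    obtain ⟨d, rfl⟩ : ∃ e, d = e + 1 := ⟨d - 1, by omega⟩
    have := ih h.2 (by omega)
    rw [Function.iterate_succ_apply]
    convert this using 1 <;> omega

/-- The `i`-th difference is multiplicative modulo the next term of the series. -/
theorem iterate_sdiff1_mul (hX : Antitone X)
    (hc : ∀ i j, ∀ a ∈ X i, ∀ b ∈ X j, gc a b ∈ X (i + j)) {d k : ℕ} (hk : 1 ≤ k) {g h : ℕ → B}
    (hg : PolySeq X d k g) (hh : PolySeq X d k h) (hX1 : X (k + d + 1) = ⊥) (n : ℕ) :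
    sdiff1^[d] (fun n => g n * h n) n = sdiff1^[d] g n * sdiff1^[d] h n := by
  induction d generalizing k g h with
  | zero => rfl
  | succ d ih =>
    obtain ⟨M, I, C⟩ := polySeq_closure hX hc d
    have hb : X (k + 1 + d + 1) = ⊥ := by rw [← hX1]; congr 1; omega
    -- As k ≥ 1, the cross term [Δg, h] starts at level k + 2, one deeper than Δg and Δh, so its
    -- d-th difference falls into the trivial term.
    have c2 := (C _ _ _ _ hg.2 hh.of_succ).mono hX (show k + 1 + 1 ≤ k + 1 + k by omega)
    have c1 := c2.mono hX (show k + 1 ≤ k + 1 + 1 by omega)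
    rw [Function.iterate_succ_apply, sdiff1_mul, ih (by omega) hg.2 (M _ _ _ c1 hh.2) hb,
      ih (by omega) c1 hh.2 hb, Function.iterate_succ_apply, Function.iterate_succ_apply]
    have h1 := (c2.iterate le_rfl).mem n
    rw [show k + 1 + 1 + d = k + 1 + d + 1 by omega, hb, Subgroup.mem_bot] at h1
    rw [h1, one_mul]

theorem sdiff1_pow_choose (x : B) (m : ℕ) :
    sdiff1 (fun n => x ^ n.choose (m + 1)) = fun n => x ^ n.choose m := by
  funext n
  rw [sdiff1, Nat.choose_succ_succ, inv_mul_eq_iff_eq_mul, ← pow_add, add_comm]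

theorem sdiff1_const (x : B) : sdiff1 (fun _ => x) = fun _ => 1 := by
  funext n
  simp [sdiff1]

theorem polySeq_pow_choose (hX : Antitone X) {k m : ℕ} {x : B} (hx : x ∈ X (k + m)) (d : ℕ) :
    PolySeq X d k (fun n => x ^ n.choose m) := by
  induction d generalizing k m with
  | zero => exact fun n => pow_mem (hX (by omega) hx) _
  | succ d ih =>
    refine ⟨fun n => pow_mem (hX (by omega) hx) _, ?_⟩
    cases m with
    | zero =>
      simp only [Nat.choose_zero_right, sdiff1_const]
      exact PolySeq.one
    | succ m =>
      rw [sdiff1_pow_choose]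
      exact ih (by rwa [show k + 1 + m = k + (m + 1) by omega])

theorem iterate_sdiff1_pow_choose (x : B) {m d : ℕ} (h : m < d) (n : ℕ) :
    sdiff1^[d] (fun n => x ^ n.choose m) n = 1 := by
  induction d generalizing m with
  | zero => omega
  | succ d ih =>
    rw [Function.iterate_succ_apply]
    cases m with
    | zero =>
      simp only [Nat.choose_zero_right, sdiff1_const]
      clear ih h
      induction d with
      | zero => rfl
      | succ d ih => rw [Function.iterate_succ_apply, sdiff1_const, ih]
    | succ m =>
      rw [sdiff1_pow_choose]
      exact ih (by omega)

theorem iterate_sdiff1_zero {g : ℕ → B} {m : ℕ} (h : ∀ i < m, g i = 1) :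
    sdiff1^[m] g 0 = g m := by
  suffices H : ∀ a n, a + n = m → sdiff1^[a] g n = g m ∧ ∀ j < n, sdiff1^[a] g j = 1 from
    (H m 0 (by omega)).1
  intro a
  induction a with
  | zero =>
    rintro n rfl
    refine ⟨by simp, fun j hj => h j (by omega)⟩
  | succ a ih =>
    intro n hn
    obtain ⟨h1, h2⟩ := ih (n + 1) (by omega)
    rw [Function.iterate_succ_apply']
    refine ⟨?_, fun j hj => ?_⟩
    · rw [sdiff1, h1, h2 n (by omega), inv_one, one_mul]
    · rw [sdiff1, h2 j (by omega), h2 (j + 1) (by omega), inv_one, one_mul]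

/-- Evaluation of a polynomial sequence at a prime `p`, in a group where `p`-th powers of deep
elements vanish. -/
theorem polySeq_eval_prime {p : ℕ} (hp : p.Prime) (hX : Antitone X)
    (hc : ∀ i j, ∀ a ∈ X i, ∀ b ∈ X j, gc a b ∈ X (i + j)) (hbot : X (p + 2) = ⊥)
    (hexp : ∀ a ∈ X 3, a ^ p = 1) {u : ℕ → B} (hu : PolySeq X p 1 u) (hu0 : u 0 = 1) :
    u p = u 1 ^ p * sdiff1^[p] u 0 := by
  obtain ⟨M, I, C⟩ := polySeq_closure hX hc p
  have hbot' : X (1 + p + 1) = ⊥ := by rw [← hbot]; congr 1; omega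
  -- Newton interpolation: dividing by E(m)^{C(n,m)} kills the value at m, keeps the earlier ones
  -- trivial, and leaves the p-th difference alone since m < p.
  have step : ∀ m, 1 ≤ m → m < p → ∀ E : ℕ → B, PolySeq X p 1 E → (∀ i < m, E i = 1) →
      ∃ E' : ℕ → B, PolySeq X p 1 E' ∧ (∀ i < m + 1, E' i = 1) ∧
        E p = E m ^ p.choose m * E' p ∧ sdiff1^[p] E' 0 = sdiff1^[p] E 0 ∧ E m ∈ X (1 + m) := by
    intro m hm hmp E hE hE1
    have hEm : E m ∈ X (1 + m) := by
      rw [← iterate_sdiff1_zero hE1]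
      exact (hE.iterate hmp.le).mem 0
    have hpow := polySeq_pow_choose hX (inv_mem hEm) p
    refine ⟨fun n => (E m)⁻¹ ^ n.choose m * E n, M _ _ _ hpow hE, fun i hi => ?_, ?_, ?_, hEm⟩
    · obtain hi | rfl : i < m ∨ i = m := by omega
      · simp [Nat.choose_eq_zero_of_lt hi, hE1 i hi]
      · simp
    · simp
    · rw [iterate_sdiff1_mul hX hc le_rfl hpow hE hbot', iterate_sdiff1_pow_choose _ hmp, one_mul]
  have main : ∀ m, 2 ≤ m → m ≤ p → ∃ E : ℕ → B, PolySeq X p 1 E ∧ (∀ i < m, E i = 1) ∧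
      u p = u 1 ^ p * E p ∧ sdiff1^[p] E 0 = sdiff1^[p] u 0 := by
    intro m hm
    induction m, hm using Nat.le_induction with
    | base =>
      intro h2
      obtain ⟨E, h1, h3, h4, h5, -⟩ := step 1 le_rfl (by omega) u hu fun i hi => by
        rw [show i = 0 by omega, hu0]
      exact ⟨E, h1, h3, by rwa [Nat.choose_one_right] at h4, h5⟩
    | succ m hm ih =>
      intro hmp
      obtain ⟨E, h1, h2, h3, h4⟩ := ih (by omega)
      obtain ⟨E', h5, h6, h7, h8, h9⟩ := step m (by omega) (by omega) E h1 h2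
      refine ⟨E', h5, h6, ?_, h8.trans h4⟩
      -- For 1 < m < p the factor E(m)^{C(p,m)} is a p-th power from X_{m+1} ≤ X_3, hence trivial.
      obtain ⟨c, hpc⟩ := hp.dvd_choose_self (k := m) (by omega) (by omega)
      rw [h3, h7, hpc, pow_mul, hexp _ (hX (by omega) h9), one_pow, one_mul]
  obtain ⟨E, -, h2, h3, h4⟩ := main p hp.two_le le_rfl
  rw [h3, ← h4, iterate_sdiff1_zero h2]

end PolynomialSequences

/-! ### The lower central series of a p-group of maximal class -/

section MaximalClass

variable {G : Type*} [Group G]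

/-- `G` is generated by `s` and `t` modulo its derived subgroup. -/
def GenPair (s t : G) : Prop := ∀ g : G, ∃ a b : ℤ, (s ^ a * t ^ b)⁻¹ * g ∈ lcs G 2

/-- The properties of the lower central series of a `p`-group of maximal class and order `p ^ n`
with `3 ≤ n`. -/
structure MaxClassSeries (p n : ℕ) (G : Type*) [Group G] : Prop where
  prime : p.Prime
  strict : ∀ i, 1 ≤ i → i < n → ¬ lcs G i ≤ lcs G (i + 1)
  bot : lcs G n = ⊥
  pow_mem : ∀ i, 1 ≤ i → ∀ x ∈ lcs G i, x ^ p ∈ lcs G (i + 1)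
  cyclic : ∀ i, 2 ≤ i → ∀ x ∈ lcs G i, x ∉ lcs G (i + 1) → ∀ y ∈ lcs G i,
    ∃ k : ℤ, (x ^ k)⁻¹ * y ∈ lcs G (i + 1)
  pair : ∃ s t : G, GenPair s t

theorem gc_mem_of_quotient_cyclic {i j : ℕ} (hij : lcs G j ≤ lcs G i)
    (hc : IsCyclic (G ⧸ lcs G i)) (h : ∀ x ∈ lcs G i, ∀ g, gc x g ∈ lcs G j) (x y : G) :
    gc x y ∈ lcs G j := by
  let f : G ⧸ lcs G j →* G ⧸ lcs G i := QuotientGroup.map _ _ (MonoidHom.id G) hij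
  have hf : f.ker ≤ Subgroup.center (G ⧸ lcs G j) := by
    intro x hx
    induction x using QuotientGroup.induction_on with
    | H x =>
      have hx' : x ∈ lcs G i := (QuotientGroup.eq_one_iff x).1 hx
      rw [Subgroup.mem_center_iff]
      intro y
      induction y using QuotientGroup.induction_on with
      | H y =>
        rw [← QuotientGroup.mk_mul, ← QuotientGroup.mk_mul, QuotientGroup.eq]
        have e : (y * x)⁻¹ * (x * y) = gc x y := by simp only [gc]; group
        rw [e]
        exact h x hx' y
  have hcomm := (f.isMulCommutative_of_isCyclic_of_ker_le_center hf).is_comm.comm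
    (x : G ⧸ lcs G j) y
  rw [← QuotientGroup.mk_mul, ← QuotientGroup.mk_mul] at hcomm
  have e : gc x y = (y * x)⁻¹ * (x * y) := by simp only [gc]; group
  rw [e]
  exact QuotientGroup.eq.1 hcomm.symm

theorem lcs_eq_of_le_succ {i : ℕ} (hi : 1 ≤ i) (h : lcs G i ≤ lcs G (i + 1)) (k : ℕ) :
    lcs G i ≤ lcs G (i + k) := by
  induction k with
  | zero => exact le_rfl
  | succ k ih =>
    refine h.trans (lcs_succ_le hi fun x hx g => ?_)
    exact gc_mem_lcs (ih hx) g

/-- The n - 1 strict inclusions, and G/γ_2 not being cyclic, leave no room in the order p^n: |G/γ_2|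
= p² and every later nontrivial factor has order p. -/
theorem IsPGroupOfMaximalClass.maxClassSeries {p n : ℕ} (hp : p.Prime) (hn : 3 ≤ n)
    (hcard : Nat.card G = p ^ n) (hnil : Group.IsNilpotent G)
    (hcl : Group.nilpotencyClass G + 1 = n) : MaxClassSeries p n G := by
  have hfact : Fact p.Prime := ⟨hp⟩
  have hfin : Finite G := Nat.finite_of_card_ne_zero (by rw [hcard]; exact (pow_pos hp.pos n).ne')
  have hbot : ∀ i, 1 ≤ i → (lcs G i = ⊥ ↔ n ≤ i) := fun i hi => by
    rw [lcs, Subgroup.lowerCentralSeries_eq_bot_iff_nilpotencyClass_le]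
    omega
  have strict : ∀ i, 1 ≤ i → i < n → ¬ lcs G i ≤ lcs G (i + 1) := by
    intro i hi hin h
    have h1 := lcs_eq_of_le_succ hi h (n - i)
    rw [show i + (n - i) = n by omega, (hbot n (by omega)).2 le_rfl, le_bot_iff, hbot i hi] at h1
    omega
  have hpow : ∀ i, ∃ k, Nat.card (lcs G i) = p ^ k := fun i => by
    obtain ⟨k, -, hk⟩ := (Nat.dvd_prime_pow hp).1 (hcard ▸ Subgroup.card_subgroup_dvd_card (lcs G i))
    exact ⟨k, hk⟩
  choose e he using hpow
  have e1 : e 1 = n := by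
    have : Nat.card (lcs G 1) = p ^ n := by
      rw [← hcard]
      exact Subgroup.card_top
    rw [he] at this
    exact Nat.pow_right_injective hp.two_le this
  have elt : ∀ i, 1 ≤ i → i < n → e (i + 1) < e i := by
    intro i hi hin
    by_contra hcon
    have h1 : Nat.card (lcs G i) ≤ Nat.card (lcs G (i + 1)) := by
      rw [he, he]
      exact Nat.pow_le_pow_right hp.pos (by omega)
    exact strict i hi hin (Subgroup.eq_of_le_of_card_ge (lcs_antitone (Nat.le_succ i)) h1).ge
  have eidx : (lcs G 2).index * p ^ e 2 = p ^ n := by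
    rw [← he, ← hcard, mul_comm, Subgroup.card_mul_index]
  -- Otherwise G/γ_3 would be a central extension of a cyclic group, hence abelian, and γ_2 = γ_3.
  have ncyc : ¬ IsCyclic (G ⧸ lcs G 2) := by
    intro h
    refine strict 2 (by omega) (by omega) (lcs_succ_le le_rfl fun x _ g => ?_)
    exact gc_mem_of_quotient_cyclic (lcs_antitone (by omega)) h
      (fun x hx g => gc_mem_lcs hx g) x g
  have e2 : e 2 ≤ n - 2 := by
    have h1 : e 2 < e 1 := elt 1 le_rfl (by omega)
    by_contra hcon
    have h2 : e 2 = n - 1 := by omega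
    refine ncyc (isCyclic_of_prime_card (p := p) ?_)
    rw [h2, show p ^ n = p * p ^ (n - 1) by rw [← pow_succ']; congr 1; omega] at eidx
    exact Nat.eq_of_mul_eq_mul_right (pow_pos hp.pos _) eidx
  have elow : ∀ k, k < n → k ≤ e (n - k) := by
    intro k
    induction k with
    | zero => omega
    | succ k ih =>
      intro hk
      have := elt (n - (k + 1)) (by omega) (by omega)
      rw [show n - (k + 1) + 1 = n - k by omega] at this
      have := ih (by omega)
      omega
  have eupp : ∀ i, 2 ≤ i → i ≤ n → e i ≤ n - i := by
    intro i hi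
    induction i, hi using Nat.le_induction with
    | base => exact fun _ => e2
    | succ i hi ih =>
      intro hin
      have := elt i (by omega) (by omega)
      have := ih (by omega)
      omega
  have eeq : ∀ i, 2 ≤ i → i ≤ n → e i = n - i := by
    intro i hi hin
    have h1 := elow (n - i) (by omega)
    rw [show n - (n - i) = i by omega] at h1
    exact le_antisymm (eupp i hi hin) h1
  have qcard : ∀ i, 2 ≤ i → i < n →
      Nat.card (lcs G i ⧸ (lcs G (i + 1)).subgroupOf (lcs G i)) = p := by
    intro i hi hin
    have h1 := Subgroup.card_eq_card_quotient_mul_card_subgroup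
      ((lcs G (i + 1)).subgroupOf (lcs G i))
    rw [Nat.card_congr (Subgroup.subgroupOfEquivOfLe (lcs_antitone (Nat.le_succ i))).toEquiv,
      he, he, eeq i hi hin.le, eeq (i + 1) (by omega) (by omega),
      show p ^ (n - i) = p * p ^ (n - (i + 1)) by rw [← pow_succ']; congr 1; omega] at h1
    exact (Nat.eq_of_mul_eq_mul_right (pow_pos hp.pos _) h1).symm
  have acard : Nat.card (G ⧸ lcs G 2) = p ^ 2 := by
    rw [eeq 2 le_rfl (by omega), show p ^ n = p ^ 2 * p ^ (n - 2) by
      rw [← pow_add]; congr 1; omega] at eidx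
    exact Nat.eq_of_mul_eq_mul_right (pow_pos hp.pos _) eidx
  have aexp : ∀ v : G ⧸ lcs G 2, v ^ p = 1 := by
    intro v
    have h1 : orderOf v ∣ p ^ 2 := acard ▸ orderOf_dvd_natCard v
    obtain ⟨k, hk, hk'⟩ := (Nat.dvd_prime_pow hp).1 h1
    have h2 : k ≠ 2 := by
      rintro rfl
      exact ncyc (isCyclic_of_orderOf_eq_card v (by rw [hk', acard]))
    rw [← orderOf_dvd_iff_pow_eq_one, hk']
    exact (pow_dvd_pow p (by omega : k ≤ 1)).trans (pow_one p).dvd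
  refine ⟨hp, strict, (hbot n (by omega)).2 le_rfl, fun i hi x hx => ?_, fun i hi x hx hx' y hy => ?_,
    ?_⟩
  · obtain rfl | hi : i = 1 ∨ 2 ≤ i := by omega
    · have := aexp x
      rwa [← QuotientGroup.mk_pow, QuotientGroup.eq_one_iff] at this
    · by_cases hin : i < n
      · have h1 : ((⟨x, hx⟩ : lcs G i) : lcs G i ⧸ (lcs G (i + 1)).subgroupOf (lcs G i)) ^ p = 1 := by
          rw [← qcard i hi hin]
          exact pow_card_eq_one'
        rw [← QuotientGroup.mk_pow, QuotientGroup.eq_one_iff, Subgroup.mem_subgroupOf] at h1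
        exact h1
      · rw [(hbot i (by omega)).2 (by omega), Subgroup.mem_bot] at hx
        rw [hx, one_pow]
        exact one_mem _
  · by_cases hin : i < n
    · have h1 : ((⟨x, hx⟩ : lcs G i) : lcs G i ⧸ (lcs G (i + 1)).subgroupOf (lcs G i)) ≠ 1 := by
        intro h
        rw [QuotientGroup.eq_one_iff, Subgroup.mem_subgroupOf] at h
        exact hx' h
      obtain ⟨k, hk⟩ := mem_zpowers_of_prime_card (qcard i hi hin) h1
        (g' := ((⟨y, hy⟩ : lcs G i) : lcs G i ⧸ (lcs G (i + 1)).subgroupOf (lcs G i)))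
      refine ⟨k, ?_⟩
      have hk' : (((⟨x, hx⟩ : lcs G i) ^ k : lcs G i) :
        lcs G i ⧸ (lcs G (i + 1)).subgroupOf (lcs G i)) = (⟨y, hy⟩ : lcs G i) := hk
      rw [QuotientGroup.eq, Subgroup.mem_subgroupOf] at hk'
      exact hk'
    · refine absurd ?_ hx'
      rw [(hbot i (by omega)).2 (by omega), Subgroup.mem_bot] at hx
      rw [hx]
      exact one_mem _
  · have hcomm : ∀ v w : G ⧸ lcs G 2, v * w = w * v :=
      (IsPGroup.isMulCommutative_of_card_eq_prime_sq acard).is_comm.comm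
    obtain ⟨t, ht⟩ : ∃ t : G ⧸ lcs G 2, t ≠ 1 := by
      have : Nontrivial (G ⧸ lcs G 2) := by
        rw [← Finite.one_lt_card_iff_nontrivial, acard]
        exact Nat.one_lt_pow two_ne_zero hp.one_lt
      exact exists_ne 1
    have hT : (Subgroup.zpowers t).Normal := ⟨fun a ha b => by
      rw [hcomm b a, mul_inv_cancel_right]; exact ha⟩
    have hTc : Nat.card ((G ⧸ lcs G 2) ⧸ Subgroup.zpowers t) = p := by
      have h1 := Subgroup.card_eq_card_quotient_mul_card_subgroup (Subgroup.zpowers t)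
      rw [Nat.card_zpowers, orderOf_eq_prime (aexp t) ht, acard, pow_two] at h1
      exact (Nat.eq_of_mul_eq_mul_right hp.pos h1).symm
    obtain ⟨s, hs⟩ : ∃ s : (G ⧸ lcs G 2) ⧸ Subgroup.zpowers t, s ≠ 1 := by
      have : Nontrivial ((G ⧸ lcs G 2) ⧸ Subgroup.zpowers t) := by
        rw [← Finite.one_lt_card_iff_nontrivial, hTc]
        exact hp.one_lt
      exact exists_ne 1
    obtain ⟨s, rfl⟩ := QuotientGroup.mk_surjective s
    obtain ⟨s, rfl⟩ := QuotientGroup.mk_surjective s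
    obtain ⟨t, rfl⟩ := QuotientGroup.mk_surjective t
    refine ⟨s, t, fun g => ?_⟩
    obtain ⟨a, ha⟩ := mem_zpowers_of_prime_card hTc hs
      (g' := ((g : G ⧸ lcs G 2) : (G ⧸ lcs G 2) ⧸ Subgroup.zpowers (t : G ⧸ lcs G 2)))
    have ha' : (((s : G ⧸ lcs G 2) ^ a : G ⧸ lcs G 2) :
      (G ⧸ lcs G 2) ⧸ Subgroup.zpowers (t : G ⧸ lcs G 2)) = (g : G ⧸ lcs G 2) := ha
    rw [QuotientGroup.eq] at ha'
    obtain ⟨b, hb⟩ := ha'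
    refine ⟨a, b, ?_⟩
    rw [← QuotientGroup.eq, QuotientGroup.mk_mul, QuotientGroup.mk_zpow, QuotientGroup.mk_zpow]
    have hb' : (t : G ⧸ lcs G 2) ^ b = ((s : G ⧸ lcs G 2) ^ a)⁻¹ * g := hb
    rw [hb', mul_inv_cancel_left]

end MaximalClass

/-! ### Moving the Bogomolov multiplier down one level -/

section Levels

variable {G : Type*} [Group G] {W : Subgroup (BogomolovMultiplier G)}

theorem lcs_two_commute (x y : G) : Commute (x : G ⧸ lcs G 2) y := by
  have h : gc x y ∈ lcs G 2 := gc_mem_lcs (mem_lcs_one x) y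
  rw [← gc_eq_one_iff]
  exact (QuotientGroup.eq_one_iff (gc x y)).2 h

theorem genPair_iff {s t : G} :
    GenPair s t ↔ ∀ g : G, ∃ a b : ℤ, (g : G ⧸ lcs G 2) = (s : G ⧸ lcs G 2) ^ a * t ^ b := by
  refine forall_congr' fun g => exists_congr fun a => exists_congr fun b => ?_
  rw [← QuotientGroup.eq, eq_comm]
  rfl

theorem GenPair.symm {s t : G} (h : GenPair s t) : GenPair t s := by
  rw [genPair_iff] at h ⊢
  intro g
  obtain ⟨a, b, hab⟩ := h g
  exact ⟨b, a, by rw [hab, ((lcs_two_commute s t).zpow_zpow a b).eq]⟩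

theorem GenPair.mul_zpow_right {s t : G} (h : GenPair s t) (k : ℤ) : GenPair s (s ^ k * t) := by
  rw [genPair_iff] at h ⊢
  intro g
  obtain ⟨a, b, hab⟩ := h g
  refine ⟨a - k * b, b, ?_⟩
  rw [hab, QuotientGroup.mk_mul, QuotientGroup.mk_zpow,
    ((lcs_two_commute s t).zpow_left k).mul_zpow, ← mul_assoc, ← zpow_mul, ← zpow_add,
    sub_add_cancel]

theorem GenPair.mul_right_left {s t : G} (h : GenPair s t) : GenPair (s * t) t := by
  have h1 := (h.symm.mul_zpow_right 1).symm
  rw [zpow_one] at h1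
  rw [genPair_iff] at h1 ⊢
  intro g
  obtain ⟨a, b, hab⟩ := h1 g
  refine ⟨a, b, ?_⟩
  rw [hab, QuotientGroup.mk_mul, QuotientGroup.mk_mul, (lcs_two_commute s t).eq]

theorem GenPair.cpr_cw_right {s t : G} (h : GenPair s t) {i m : ℕ} (hi : 1 ≤ i) (hm : m ≤ i + 1)
    (g : G) : ∃ a b : ℤ, ∀ x ∈ lcs G i,
      cpr W m (cw x g) = cpr W m (cw x s) ^ a * cpr W m (cw x t) ^ b := by
  obtain ⟨a, b, hab⟩ := h g
  refine ⟨a, b, fun x hx => ?_⟩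
  rw [cpr_cw_congr_right le_rfl hi (by omega) (mem_lcs_one _) hab hx,
    cpr_cw_mul_right hi le_rfl hm hx (mem_lcs_one _),
    cpr_cw_zpow_right hi le_rfl hm hx (mem_lcs_one _),
    cpr_cw_zpow_right hi le_rfl hm hx (mem_lcs_one _)]

/-- An alternating form on a group with two generators is a determinant times t ⋏ s. -/
theorem GenPair.cpr_cw_two {s t : G} (h : GenPair s t) (x y : G) :
    ∃ j : ℤ, cpr W 2 (cw x y) = cpr W 2 (cw t s) ^ j := by
  obtain ⟨a, b, hab⟩ := h.cpr_cw_right (W := W) le_rfl le_rfl y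
  obtain ⟨c, d, hcd⟩ := h.cpr_cw_right (W := W) le_rfl le_rfl x
  have hs := hcd s (mem_lcs_one s)
  have ht := hcd t (mem_lcs_one t)
  rw [cw_self, map_one, one_zpow, one_mul, cpr_cw_swap t s, ← zpow_neg_one, ← zpow_mul] at hs
  rw [cw_self, map_one, one_zpow, mul_one] at ht
  refine ⟨d * a - c * b, ?_⟩
  rw [hab x (mem_lcs_one x), cpr_cw_swap s x, cpr_cw_swap t x, hs, ht, ← zpow_neg_one,
    ← zpow_neg_one, ← zpow_mul, ← zpow_mul, ← zpow_mul, ← zpow_mul, ← zpow_add]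
  congr 1
  ring

theorem dvd_of_zpow_mem {p : ℕ} (hp : p.Prime) {H : Subgroup G} {c : G} (h1 : c ^ p ∈ H)
    (h2 : c ∉ H) {j : ℤ} (h3 : c ^ j ∈ H) : (p : ℤ) ∣ j := by
  by_contra hj
  obtain ⟨u, v, huv⟩ := (Prime.coprime_iff_not_dvd (Nat.prime_iff_prime_int.1 hp)).2 hj
  apply h2
  rw [← zpow_one c, ← huv, zpow_add, mul_comm u, mul_comm v, zpow_mul, zpow_mul, zpow_natCast]
  exact mul_mem (zpow_mem h1 u) (zpow_mem h3 v)

namespace MaxClassSeries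

variable {p n : ℕ} (h : MaxClassSeries p n G)
include h

theorem exists_gen {i : ℕ} (hi : 1 ≤ i) (hin : i < n) : ∃ x ∈ lcs G i, x ∉ lcs G (i + 1) :=
  SetLike.not_le_iff_exists.1 (h.strict i hi hin)

theorem cpr_cw_expand {s t : G} (hst : GenPair s t) {l : ℕ} (hl : 2 ≤ l) {x : G}
    (hx : x ∈ lcs G l) (hx' : x ∉ lcs G (l + 1)) {y : G} (hy : y ∈ lcs G l) (g : G) :
    ∃ j k : ℤ, cpr W (l + 1) (cw y g) =
      cpr W (l + 1) (cw x s) ^ j * cpr W (l + 1) (cw x t) ^ k := by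
  obtain ⟨a, b, hab⟩ := hst.cpr_cw_right (W := W) (show 1 ≤ l by omega) le_rfl g
  obtain ⟨m, hm⟩ := h.cyclic l hl x hx hx' y hy
  refine ⟨a * m, b * m, ?_⟩
  rw [cpr_cw_congr_left (by omega) le_rfl le_rfl (zpow_mem hx m) hm (mem_lcs_one g),
    cpr_cw_zpow_left (by omega) le_rfl le_rfl hx (mem_lcs_one g), hab x hx,
    Commute.mul_zpow, zpow_mul, zpow_mul]
  exact (cpr_commute (cw_mem_cfil hx s) _).zpow_zpow a b

/-- If [x, s] and [x, t] were both in γ_{l+2}, bilinearity would give γ_{l+1} = γ_{l+2}, against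
strictness. -/
theorem gc_s_notMem {s t : G} (hst : GenPair s t) {l : ℕ} (hl : 2 ≤ l) (hln : l + 1 < n) {x : G}
    (hx : x ∈ lcs G l) (hx' : x ∉ lcs G (l + 1)) (hxt : gc x t ∈ lcs G (l + 2)) :
    gc x s ∉ lcs G (l + 2) := by
  intro hxs
  refine h.strict (l + 1) (by omega) hln (lcs_succ_le (by omega) fun y hy g => ?_)
  obtain ⟨j, k, hjk⟩ := h.cpr_cw_expand (W := ⊥) hst hl hx hx' hy g
  rw [← map_zpow, ← map_zpow, ← map_mul, eq_comm, cpr_eq_iff] at hjk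
  have := ckap_mem_lcs hjk
  rw [map_mul, map_inv, map_mul, map_zpow, map_zpow, ckap_cw, ckap_cw, ckap_cw] at this
  have h2 := mul_mem (mul_mem (zpow_mem hxs j) (zpow_mem hxt k)) this
  rwa [mul_inv_cancel_left] at h2

theorem gc_t_s_notMem {s t : G} (hst : GenPair s t) (hn : 3 ≤ n) : gc t s ∉ lcs G 3 := by
  intro hts
  refine h.strict 2 (by omega) (by omega) (lcs_succ_le le_rfl fun x _ g => ?_)
  obtain ⟨j, hj⟩ := hst.cpr_cw_two (W := ⊥) x g
  rw [← map_zpow, eq_comm, cpr_eq_iff] at hj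
  have := ckap_mem_lcs hj
  rw [map_mul, map_inv, map_zpow, ckap_cw, ckap_cw] at this
  have h2 := mul_mem (zpow_mem hts j) this
  rwa [mul_inv_cancel_left] at h2

/-- If `γ_l ⋏ G` is cyclic modulo the next term of the filtration, generated by an element with
nontrivial commutator, then the Bogomolov multiplier moves down in the filtration. -/
theorem ker_le_succ {l : ℕ} (hl : 1 ≤ l) {x s : G} (hx : x ∈ lcs G l)
    (hxs : gc x s ∉ lcs G (l + 2))
    (hgen : ∀ y ∈ lcs G l, ∀ g, ∃ j : ℤ, cpr W (l + 1) (cw y g) = cpr W (l + 1) (cw x s) ^ j)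
    (hN : (ckap (G := G)).ker ≤ cfil W (l + 1)) : (ckap (G := G)).ker ≤ cfil W (l + 2) := by
  have h1 : cfil W (l + 1) ≤ (Subgroup.zpowers (cpr W (l + 1) (cw x s))).comap (cpr W (l + 1)) := by
    refine cfil_le (fun y hy g => ?_) fun w hw => ?_
    · obtain ⟨j, hj⟩ := hgen y hy g
      exact ⟨j, hj.symm⟩
    · rw [Subgroup.mem_comap, cpr_eq_one_iff.2 (mem_cfil_of_mem hw)]
      exact one_mem _
  -- Modulo R_{l+2}, q is (x ⋏ s)^j. Since [x, s]^j ∈ γ_{l+2}, p divides j; and (x ⋏ s)^p is x^p ⋏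
  -- s, which is trivial there.
  intro q hq
  obtain ⟨j, hj⟩ := h1 (hN hq)
  have hj : cpr W (l + 1) (cw x s) ^ j = cpr W (l + 1) q := hj
  rw [← cpr_eq_one_iff, ← hj]
  rw [← map_zpow, cpr_eq_iff] at hj
  have h2 := ckap_mem_lcs hj
  rw [map_mul, map_inv, map_zpow, ckap_cw, MonoidHom.mem_ker.1 hq, mul_one, inv_mem_iff] at h2
  obtain ⟨k, rfl⟩ := dvd_of_zpow_mem h.prime (h.pow_mem _ (by omega) _ (gc_mem_lcs hx s)) hxs h2
  rw [zpow_mul, ← cpr_cw_zpow_left (by omega) le_rfl le_rfl hx (mem_lcs_one s), zpow_natCast,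
    cpr_cw_eq_one (i := l + 1) (by omega) le_rfl le_rfl (h.pow_mem _ hl _ hx) (mem_lcs_one s),
    one_zpow]

theorem ker_le_succ_of_cw_mem {s t : G} (hst : GenPair s t) {l : ℕ} (hl : 2 ≤ l) (hln : l + 1 < n)
    {x : G} (hx : x ∈ lcs G l) (hx' : x ∉ lcs G (l + 1)) (hxt : cw x t ∈ cfil W (l + 2))
    (hN : (ckap (G := G)).ker ≤ cfil W (l + 1)) : (ckap (G := G)).ker ≤ cfil W (l + 2) := by
  have hxt' : gc x t ∈ lcs G (l + 2) := by
    rw [← ckap_cw]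
    exact ckap_mem_lcs hxt
  refine h.ker_le_succ (by omega) hx (h.gc_s_notMem hst hl hln hx hx' hxt') (fun y hy g => ?_) hN
  obtain ⟨j, k, hjk⟩ := h.cpr_cw_expand (W := W) hst hl hx hx' hy g
  refine ⟨j, ?_⟩
  rw [hjk, cpr_eq_one_iff.2 hxt, one_zpow, mul_one]

theorem ker_le_three {s t : G} (hst : GenPair s t) (hn : 3 ≤ n) :
    (ckap (G := G)).ker ≤ cfil W 3 :=
  h.ker_le_succ le_rfl (mem_lcs_one t) (h.gc_t_s_notMem hst hn) (fun y _ g => hst.cpr_cw_two y g)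
    (by rw [cfil_eq_top (by omega)]; exact le_top)

/-- Some generating pair has its second member centralizing `γ_l` modulo `γ_{l+2}`. -/
theorem exists_genPair_centralizing {l : ℕ} (hl : 2 ≤ l) {x : G} (hx : x ∈ lcs G l) :
    ∃ s t : G, GenPair s t ∧ gc x t ∈ lcs G (l + 2) := by
  obtain ⟨s, t, hst⟩ := h.pair
  by_cases hxs : gc x s ∈ lcs G (l + 2)
  · exact ⟨t, s, hst.symm, hxs⟩
  · obtain ⟨k, hk⟩ := h.cyclic (l + 1) (by omega) (gc x s) (gc_mem_lcs hx s) hxs (gc x t)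
      (gc_mem_lcs hx t)
    -- As [x, s] generates γ_{l+1}/γ_{l+2} and [x, t] ≡ [x, s]^k, the factor s^{-k} cancels the
    -- contribution of t.
    refine ⟨s, s ^ (-k) * t, hst.mul_zpow_right _, ?_⟩
    have h1 := cpr_cw_mul_right (W := ⊥) (show 1 ≤ l by omega) le_rfl (le_refl (l + 1)) hx
      (mem_lcs_one (s ^ (-k))) (z := t)
    rw [cpr_cw_zpow_right (by omega) le_rfl le_rfl hx (mem_lcs_one s), ← map_zpow, ← map_mul,
      eq_comm, cpr_eq_iff] at h1
    have h2 := ckap_mem_lcs h1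
    rw [map_mul, map_inv, map_mul, map_zpow, ckap_cw, ckap_cw, ckap_cw, zpow_neg] at h2
    have h3 := mul_mem hk h2
    rwa [mul_inv_cancel_left] at h3

/-- Given [x, t] ∈ γ_{l+2}, some r ∈ R_{l+2} has the same commutator as x ⋏ t, and w = (x ⋏ t) r⁻¹.
Taking r for the trivial W makes w independent of W. -/
theorem exists_step_element {l : ℕ} (hl : 2 ≤ l) (hln : l + 1 < n) :
    ∃ w : BogomolovMultiplier G, ∀ W, w ∈ W → (ckap (G := G)).ker ≤ cfil W (l + 1) →
      (ckap (G := G)).ker ≤ cfil W (l + 2) := by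
  obtain ⟨x, hx, hx'⟩ := h.exists_gen (show 1 ≤ l by omega) (by omega)
  obtain ⟨s, t, hst, hxt⟩ := h.exists_genPair_centralizing hl hx
  obtain ⟨r, hr, hrt⟩ := exists_mem_cfil_ckap_eq (W := ⊥) (by omega) hxt
  have hw : cw x t * r⁻¹ ∈ BogomolovMultiplier G := by
    rw [mem_ker_curlyHom_iff, map_mul, map_inv, hrt, ckap_cw, mul_inv_cancel]
  refine ⟨⟨_, hw⟩, fun W hwW hN => h.ker_le_succ_of_cw_mem hst hl hln hx hx' ?_ hN⟩
  have h1 := mul_mem (mem_cfil_of_mem (m := l + 2) hwW) (cfil_mono bot_le (l + 2) hr)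
  simpa using h1

end MaxClassSeries

end Levels

/-! ### Levels above p: comparing p-th powers of s and st -/

section PowerStep

variable {G : Type*} [Group G] {W : Subgroup (BogomolovMultiplier G)}

/-- The left normed commutators `e₁ = t`, `e_{i+1} = [e_i, s]`. -/
def lnc (s t : G) (i : ℕ) : G := (fun z => gc z s)^[i - 1] t

theorem lnc_one (s t : G) : lnc s t 1 = t := rfl

theorem lnc_succ (s t : G) {i : ℕ} (hi : 1 ≤ i) : lnc s t (i + 1) = gc (lnc s t i) s := by
  rw [lnc, lnc, show i + 1 - 1 = i - 1 + 1 by omega, Function.iterate_succ_apply']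

theorem lnc_mem_lcs (s t : G) {i : ℕ} (hi : 1 ≤ i) : lnc s t i ∈ lcs G i := by
  induction i, hi using Nat.le_induction with
  | base => exact mem_lcs_one _
  | succ i hi ih =>
    rw [lnc_succ s t hi]
    exact gc_mem_lcs ih s

theorem ckap_of_cpr_eq {m : ℕ} {q r : CurlySquare G} (h : cpr W m q = cpr W m r) :
    (ckap q)⁻¹ * ckap r ∈ lcs G (m + 1) := by
  have := ckap_mem_lcs (cpr_eq_iff.1 h)
  rwa [map_mul, map_inv] at this

/-- The class of `[x, g]` modulo `γ_{i+2}` depends on the class of `x` in `γ_i / γ_{i+1}`. -/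
theorem gc_mem_of_congr {i : ℕ} (hi : 1 ≤ i) {x y g : G} (hx : x ∈ lcs G i)
    (hxy : x⁻¹ * y ∈ lcs G (i + 1)) (h : gc x g ∈ lcs G (i + 2)) : gc y g ∈ lcs G (i + 2) := by
  have h1 := ckap_of_cpr_eq (cpr_cw_congr_left (W := ⊥) hi le_rfl (le_refl (i + 1)) hx hxy
    (mem_lcs_one g)).symm
  rw [ckap_cw, ckap_cw] at h1
  have := mul_mem h h1
  rwa [mul_inv_cancel_left] at this

theorem gc_mul_congr {i : ℕ} (hi : 1 ≤ i) {x y s t : G} (hx : x ∈ lcs G i)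
    (hxy : x⁻¹ * y ∈ lcs G (i + 1)) (h : gc x t ∈ lcs G (i + 2)) :
    (gc x s)⁻¹ * gc y (s * t) ∈ lcs G (i + 2) := by
  have h1 := cpr_cw_congr_left (W := ⊥) hi le_rfl (le_refl (i + 1)) hx hxy (mem_lcs_one (s * t))
  rw [cpr_cw_mul_right hi le_rfl le_rfl hx (mem_lcs_one s), ← map_mul] at h1
  have h2 := ckap_of_cpr_eq h1.symm
  rw [map_mul, ckap_cw, ckap_cw, ckap_cw] at h2
  have h3 := mul_mem h h2
  rwa [mul_inv_rev, mul_assoc, mul_inv_cancel_left] at h3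

/-- As t centralizes the relevant e_i one level deeper, replacing s by st does not change their
leading terms; so st inherits the properties of s. -/
theorem lnc_mul_congr {s t : G} {m : ℕ} (h : ∀ i, 1 ≤ i → i < m → gc (lnc s t i) t ∈ lcs G (i + 2))
    {i : ℕ} (hi : 1 ≤ i) (him : i ≤ m) :
    (lnc s t i)⁻¹ * lnc (s * t) t i ∈ lcs G (i + 1) := by
  induction i, hi using Nat.le_induction with
  | base => rw [lnc_one, lnc_one, inv_mul_cancel]; exact one_mem _
  | succ i hi ih =>
    rw [lnc_succ _ _ hi, lnc_succ _ _ hi]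
    exact gc_mul_congr hi (lnc_mem_lcs s t hi) (ih (by omega)) (h i hi (by omega))

/-- The elements over `γ_l(G)` lie in the filtration as soon as the Bogomolov multiplier does. -/
theorem mem_cfil_of_ckap_mem {l : ℕ} (hN : (ckap (G := G)).ker ≤ cfil W l) {m : ℕ} (hml : m ≤ l)
    {q : CurlySquare G} (hq : ckap q ∈ lcs G m) : q ∈ cfil W m := by
  obtain hm | hm : m ≤ 2 ∨ 2 ≤ m := by omega
  · rw [cfil_eq_top hm]; trivial
  · obtain ⟨r, hr, hrq⟩ := exists_mem_cfil_ckap_eq (W := W) hm hq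
    have h1 : q * r⁻¹ ∈ (ckap (G := G)).ker := by
      rw [MonoidHom.mem_ker, map_mul, map_inv, hrq, mul_inv_cancel]
    have h2 := mul_mem (cfil_antitone hml (hN h1)) hr
    rwa [inv_mul_cancel_right] at h2

/-- The image in `G ⋏ G` modulo `cfil W (l + 1)` of the series
`R_a, R_a, R_a, R_{a+1}, R_{a+2}, …`. -/
def shiftedFil (W : Subgroup (BogomolovMultiplier G)) (l a j : ℕ) :
    Subgroup (CurlySquare G ⧸ cfil W (l + 1)) :=
  (cfil W (a + (j - 2))).map (cpr W l)

theorem shiftedFil_antitone (l a : ℕ) : Antitone (shiftedFil W l a) := fun i j hij =>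
  Subgroup.map_mono (cfil_antitone (by omega))

/-- The repeated initial terms are needed because n ↦ x ⋏ s^n and its first difference both start in
R_a. Commutators have room for this shift since a ≥ 2. -/
theorem shiftedFil_gc {l a : ℕ} (ha : 2 ≤ a) (i j : ℕ) :
    ∀ x ∈ shiftedFil W l a i, ∀ y ∈ shiftedFil W l a j, gc x y ∈ shiftedFil W l a (i + j) := by
  rintro _ ⟨x, hx, rfl⟩ _ ⟨y, hy, rfl⟩
  refine ⟨gc x y, cfil_antitone ?_ (gc_mem_cfil_add (by omega) (by omega) hx hy), ?_⟩
  · omega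
  · simp only [gc, map_mul, map_inv]

theorem shiftedFil_eq_bot {l a j : ℕ} (h : l + 1 ≤ a + (j - 2)) : shiftedFil W l a j = ⊥ := by
  rw [eq_bot_iff]
  rintro _ ⟨x, hx, rfl⟩
  exact Subgroup.mem_bot.2 (cpr_eq_one_iff.2 (cfil_antitone h hx))

theorem sdiff1_cact (l : ℕ) (s : G) (q : CurlySquare G) :
    sdiff1 (fun n => cpr W l (cact (s ^ n) q)) =
      fun n => cpr W l (cact (s ^ n) (cw (ckap q) s)) := by
  funext n
  rw [sdiff1, ← map_inv, ← map_mul, pow_succ', cact_mul, ← map_inv, ← map_mul, inv_mul_cact]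

theorem polySeq_cact {l a : ℕ} (s : G) (d : ℕ) {k : ℕ} (hk : 2 ≤ k) {q : CurlySquare G}
    (hq : q ∈ cfil W (a + (k - 2))) :
    PolySeq (shiftedFil W l a) d k (fun n => cpr W l (cact (s ^ n) q)) := by
  have h0 : ∀ n : ℕ, cpr W l (cact (s ^ n) q) ∈ shiftedFil W l a k := fun n =>
    ⟨_, cact_mem_cfil hq _, rfl⟩
  induction d generalizing k q with
  | zero => exact h0
  | succ d ih =>
    refine ⟨h0, ?_⟩
    rw [sdiff1_cact]
    have hq' : cw (ckap q) s ∈ cfil W (a + (k + 1 - 2)) := by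
      rw [show a + (k + 1 - 2) = a + (k - 2) + 1 by omega]
      exact cw_mem_cfil (ckap_mem_lcs hq) s
    exact ih (by omega) hq' fun n => ⟨_, cact_mem_cfil hq' _, rfl⟩

theorem sdiff1_cw_pow (l : ℕ) (x s : G) :
    sdiff1 (fun n => cpr W l (cw x (s ^ n))) = fun n => cpr W l (cact (s ^ n) (cw x s)) := by
  funext n
  rw [sdiff1, pow_succ', cw_mul_right, map_mul, inv_mul_cancel_left]

theorem polySeq_cw_pow {l a : ℕ} (s : G) (d : ℕ) {x : G} (hx : x ∈ lcs G (a - 1)) (ha : 1 ≤ a) :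
    PolySeq (shiftedFil W l a) d 1 (fun n => cpr W l (cw x (s ^ n))) := by
  have hq : ∀ g : G, cw x g ∈ cfil W a := fun g => by
    have := cw_mem_cfil (W := W) hx g
    rwa [Nat.sub_add_cancel ha] at this
  have h0 : ∀ n : ℕ, cpr W l (cw x (s ^ n)) ∈ shiftedFil W l a 1 := fun n => ⟨_, hq _, rfl⟩
  cases d with
  | zero => exact h0
  | succ d =>
    refine ⟨h0, ?_⟩
    rw [sdiff1_cw_pow]
    exact polySeq_cact s d le_rfl (hq s)

theorem iterate_sdiff1_cact (l : ℕ) (s : G) (d : ℕ) (x : G) :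
    sdiff1^[d] (fun n => cpr W l (cact (s ^ n) (cw x s))) =
      fun n => cpr W l (cact (s ^ n) (cw ((fun z => gc z s)^[d] x) s)) := by
  induction d generalizing x with
  | zero => rfl
  | succ d ih => rw [Function.iterate_succ_apply, sdiff1_cact, ckap_cw, ih,
      Function.iterate_succ_apply]

theorem iterate_sdiff1_cw_pow_zero (l : ℕ) (s : G) {d : ℕ} (hd : 1 ≤ d) (x : G) :
    sdiff1^[d] (fun n => cpr W l (cw x (s ^ n))) 0 =
      cpr W l (cw ((fun z => gc z s)^[d - 1] x) s) := by
  obtain ⟨d, rfl⟩ : ∃ e, d = e + 1 := ⟨d - 1, by omega⟩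
  rw [Function.iterate_succ_apply, sdiff1_cw_pow, iterate_sdiff1_cact]
  simp only [pow_zero, cact_one, Nat.add_sub_cancel]

namespace MaxClassSeries

variable {p n : ℕ} (h : MaxClassSeries p n G)
include h

theorem lnc_notMem {s t : G} (hst : GenPair s t) (hn : 3 ≤ n) {m : ℕ}
    (hc : ∀ i, 2 ≤ i → i < m → gc (lnc s t i) t ∈ lcs G (i + 2)) {i : ℕ} (hi : 1 ≤ i)
    (him : i ≤ m) (hin : i < n) : lnc s t i ∉ lcs G (i + 1) := by
  induction i, hi using Nat.le_induction with
  | base =>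
    intro ht
    exact h.gc_t_s_notMem hst hn (gc_mem_lcs ht s)
  | succ i hi ih =>
    obtain rfl | hi2 : i = 1 ∨ 2 ≤ i := by omega
    · exact h.gc_t_s_notMem hst hn
    · rw [lnc_succ s t hi]
      exact h.gc_s_notMem hst hi2 hin (lnc_mem_lcs s t hi) (ih (by omega) (by omega))
        (hc i hi2 (by omega))

/-- If s^p ≡ e_j^k modulo γ_{j+1}, then 1 = [s^p, s] ≡ e_{j+1}^k modulo γ_{j+2}, so p divides k and
s^p lies one step deeper. -/
theorem pow_mem_lcs {s t : G} {m : ℕ} (hm : 2 ≤ m)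
    (hc : ∀ i, 1 ≤ i → i ≤ m → lnc s t i ∉ lcs G (i + 1)) : s ^ p ∈ lcs G m := by
  induction m, hm using Nat.le_induction with
  | base => exact h.pow_mem 1 le_rfl s (mem_lcs_one s)
  | succ j hj ih =>
    have hsj := ih fun i hi hij => hc i hi (by omega)
    have he := lnc_mem_lcs s t (show 1 ≤ j by omega)
    obtain ⟨k, hk⟩ := h.cyclic j hj _ he (hc j (by omega) (by omega)) _ hsj
    have h1 := cpr_cw_congr_left (W := ⊥) (by omega) le_rfl (le_refl (j + 1)) (zpow_mem he k) hk
      (mem_lcs_one s)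
    rw [cpr_cw_zpow_left (by omega) le_rfl le_rfl he (mem_lcs_one s),
      cw_of_commute ((Commute.refl s).pow_left p), ← map_zpow] at h1
    have h2 := ckap_of_cpr_eq h1
    rw [map_one, inv_one, one_mul, map_zpow, ckap_cw, ← lnc_succ s t (by omega)] at h2
    obtain ⟨c, rfl⟩ := dvd_of_zpow_mem h.prime
      (h.pow_mem _ (by omega) _ (lnc_mem_lcs s t (by omega))) (hc (j + 1) (by omega) le_rfl) h2
    have h3 : lnc s t j ^ ((p : ℤ) * c) ∈ lcs G (j + 1) := by
      rw [zpow_mul, zpow_natCast]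
      exact zpow_mem (h.pow_mem j (by omega) _ he) c
    have h4 := mul_mem h3 hk
    rwa [mul_inv_cancel_left] at h4

/-- Every element of `γ_a` is a commutator with `s`, modulo `γ_b`. -/
theorem exists_gc_eq {s t : G} {l : ℕ} (hc : ∀ i, 1 ≤ i → i < l → lnc s t i ∉ lcs G (i + 1))
    {a b : ℕ} (ha : 3 ≤ a) (hab : a ≤ b) (hbl : b ≤ l) {z : G} (hz : z ∈ lcs G a) :
    ∃ x ∈ lcs G (a - 1), (gc x s)⁻¹ * z ∈ lcs G b := by
  induction b, hab using Nat.le_induction with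
  | base => exact ⟨1, one_mem _, by simpa [gc] using hz⟩
  | succ b hab ih =>
    obtain ⟨x, hx, hxz⟩ := ih (by omega)
    obtain ⟨c, rfl⟩ : ∃ c, b = c + 1 := ⟨b - 1, by omega⟩
    have he := lnc_mem_lcs s t (show 1 ≤ c by omega)
    obtain ⟨k, hk⟩ := h.cyclic (c + 1) (by omega) _ (lnc_mem_lcs s t (by omega))
      (hc (c + 1) (by omega) (by omega)) _ hxz
    have hy := zpow_mem he k
    -- The error in γ_{c+1} is a power of e_{c+1} = [e_c, s], so a power of e_c corrects it.
    refine ⟨x * lnc s t c ^ k, mul_mem hx (lcs_antitone (by omega) hy), ?_⟩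
    have h1 := cpr_cw_zpow_left (W := ⊥) (by omega) le_rfl (le_refl (c + 1)) he (mem_lcs_one s) k
    rw [← map_zpow] at h1
    have h2 := ckap_of_cpr_eq h1
    rw [map_zpow, ckap_cw, ckap_cw, ← lnc_succ s t (by omega)] at h2
    set y := lnc s t c ^ k
    have hxs : gc x s ∈ lcs G a := by
      have := gc_mem_lcs hx s
      rwa [show a - 1 + 1 = a by omega] at this
    have h3 : gc (gc x s) y ∈ lcs G (c + 1 + 1) :=
      lcs_antitone (by omega) (gc_mem_lcs_add (by omega) (by omega) hxs hy)
    have h4 := mul_mem h2 hk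
    rw [mul_assoc, mul_inv_cancel_left] at h4
    have e : (gc (x * y) s)⁻¹ * z =
        (gc y s)⁻¹ * (gc (gc x s) y)⁻¹ * (gc y s) * ((gc y s)⁻¹ * ((gc x s)⁻¹ * z)) := by
      rw [gc_mul_left]
      simp only [gc]
      group
    rw [e]
    exact mul_mem (conj_mem_lcs (inv_mem h3) _) h4

theorem cpr_pow_eq_one {l : ℕ} (hl : 2 ≤ l) {q : CurlySquare G} (hq : q ∈ cfil W l) :
    cpr W l q ^ p = 1 := by
  let H : Subgroup (CurlySquare G) :=
    { carrier := {q | q ∈ cfil W l ∧ cpr W l q ^ p = 1}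
      one_mem' := ⟨one_mem _, by rw [map_one, one_pow]⟩
      mul_mem' := fun {a b} ha hb => ⟨mul_mem ha.1 hb.1, by
        rw [map_mul, (cpr_commute ha.1 b).mul_pow, ha.2, hb.2, one_mul]⟩
      inv_mem' := fun {a} ha => ⟨inv_mem ha.1, by rw [map_inv, inv_pow, ha.2, inv_one]⟩ }
  suffices hH : cfil W l ≤ H from (hH hq).2
  refine cfil_le (fun x hx g => ⟨?_, ?_⟩) fun w hw => ⟨mem_cfil_of_mem hw, ?_⟩
  · exact cfil_antitone (by omega) (cw_mem_cfil hx g)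
  · rw [← zpow_natCast, ← cpr_cw_zpow_left (by omega) le_rfl (by omega) hx (mem_lcs_one g),
      zpow_natCast]
    exact cpr_cw_eq_one (i := l - 1 + 1) (by omega) le_rfl (by omega)
      (h.pow_mem _ (by omega) _ hx) (mem_lcs_one g)
  · rw [cpr_eq_one_iff.2 (mem_cfil_of_mem hw), one_pow]

/-- Descending induction on a. Modulo R_l, q is x ⋏ s, and evaluating n ↦ x ⋏ s^n at p equates (x ⋏
s)^p with x ⋏ s^p: the p-th difference lies in R_{a+p-1} ≤ R_{l+1}. The latter symbol is trivial
because s^p is deep. -/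
theorem pow_mem_cfil {s t : G} {l : ℕ} (hpl : p + 1 ≤ l)
    (hN : (ckap (G := G)).ker ≤ cfil W l)
    (hc : ∀ i, 1 ≤ i → i < l → lnc s t i ∉ lcs G (i + 1)) (hs : s ^ p ∈ lcs G (l - 1))
    {a : ℕ} (ha : l + 2 ≤ a + p) (hal : a ≤ l + 1) {q : CurlySquare G} (hq : q ∈ cfil W a) :
    cpr W l q ^ p = 1 := by
  have hp := h.prime.two_le
  induction hal using Nat.decreasingInduction generalizing q with
  | self => rw [cpr_eq_one_iff.2 hq, one_pow]
  | of_succ a hal ih =>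
    obtain rfl | hal : a = l ∨ a < l := by omega
    · exact h.cpr_pow_eq_one (by omega) hq
    obtain ⟨x, hx, hxq⟩ := h.exists_gc_eq hc (by omega) hal.le le_rfl (ckap_mem_lcs hq)
    obtain ⟨v, hv, rfl⟩ : ∃ v ∈ cfil W l, q = cw x s * v :=
      ⟨(cw x s)⁻¹ * q, mem_cfil_of_ckap_mem hN le_rfl (by rwa [map_mul, map_inv, ckap_cw]),
        by group⟩
    rw [map_mul, (cpr_commute hv _).symm.mul_pow, h.cpr_pow_eq_one (by omega) hv, mul_one]
    have hu := polySeq_cw_pow (W := W) (l := l) s p hx (by omega)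
    have hev := polySeq_eval_prime h.prime (shiftedFil_antitone l a) (shiftedFil_gc (by omega))
      (shiftedFil_eq_bot (by omega)) ?_ hu (by rw [pow_zero, cw_one_right, map_one])
    · have h1 := (hu.iterate le_rfl).mem 0
      rw [shiftedFil_eq_bot (by omega), Subgroup.mem_bot] at h1
      rw [h1, mul_one, pow_one] at hev
      rw [← hev]
      exact cpr_cw_eq_one (by omega) (by omega) (by omega) hx hs
    · rintro _ ⟨r, hr, rfl⟩
      exact ih (by omega) hr

theorem cw_lnc_mem_of_lt {s t : G} (hst : GenPair s t) {l : ℕ} (hl : 3 ≤ l) (hln : l < n)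
    (hpl : p + 2 ≤ l ∨ p = 2) (hN : (ckap (G := G)).ker ≤ cfil W l)
    (h2 : gc (lnc s t 2) t ∈ lcs G 4)
    (hc : ∀ i, 1 ≤ i → i + 1 < l → gc (lnc s t i) t ∈ lcs G (i + 2)) :
    cw (lnc s t (l - 1)) t ∈ cfil W (l + 1) := by
  have hp := h.prime.two_le
  -- γ_m will contain s^p and (st)^p. Triviality of y ⋏ s^p needs m ≥ p + 1, so m = l - 1 is too
  -- small exactly for l = 3, p = 2.
  obtain ⟨m, hm3, hml, hmn, hm⟩ : ∃ m, 3 ≤ m ∧ l ≤ m + 1 ∧ m < n ∧ (m + 1 ≤ l ∨ m = 3) := by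
    obtain rfl | hl : l = 3 ∨ 4 ≤ l := by omega
    · exact ⟨3, by omega⟩
    · exact ⟨l - 1, by omega⟩
  have hc' : ∀ i, 1 ≤ i → i < m → gc (lnc s t i) t ∈ lcs G (i + 2) := by
    intro i hi him
    by_cases hil : i + 1 < l
    · exact hc i hi hil
    · obtain rfl | rfl : i = 1 ∨ i = 2 := by omega
      · omega
      · exact h2
  have hcg : ∀ i, 1 ≤ i → i < m → gc (lnc (s * t) t i) t ∈ lcs G (i + 2) := fun i hi him =>
    gc_mem_of_congr hi (lnc_mem_lcs s t hi) (lnc_mul_congr hc' hi him.le) (hc' i hi him)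
  have hes : ∀ i, 1 ≤ i → i ≤ m → lnc s t i ∉ lcs G (i + 1) := fun i hi him =>
    h.lnc_notMem hst (by omega) (fun j hj => hc' j (by omega)) hi him (by omega)
  have heg : ∀ i, 1 ≤ i → i ≤ m → lnc (s * t) t i ∉ lcs G (i + 1) := fun i hi him =>
    h.lnc_notMem hst.mul_right_left (by omega) (fun j hj => hcg j (by omega)) hi him (by omega)
  have hsp := h.pow_mem_lcs (by omega) hes
  have hgp := h.pow_mem_lcs (by omega) heg
  have hexp : ∀ x ∈ shiftedFil W l (l - p + 1) 3, x ^ p = 1 := by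
    rintro _ ⟨r, hr, rfl⟩
    exact h.pow_mem_cfil (by omega) hN (fun i hi hil => hes i hi (by omega))
      (lcs_antitone (by omega) hsp) (by omega) (by omega) hr
  set y := lnc s t (l - p) with hydef
  have hy : y ∈ lcs G (l - p) := lnc_mem_lcs s t (by omega)
  have hX := shiftedFil_antitone (W := W) l (l - p + 1)
  have hXc := shiftedFil_gc (W := W) (l := l) (show 2 ≤ l - p + 1 by omega)
  have hbot : shiftedFil W l (l - p + 1) (p + 2) = ⊥ := shiftedFil_eq_bot (by omega)
  have hbot' : shiftedFil W l (l - p + 1) (1 + p + 1) = ⊥ := shiftedFil_eq_bot (by omega)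
  obtain ⟨M, I, -⟩ := polySeq_closure hX hXc p
  have hus := polySeq_cw_pow (W := W) (l := l) (a := l - p + 1) s p (x := y) (by simpa) (by omega)
  have hug := polySeq_cw_pow (W := W) (l := l) (a := l - p + 1) (s * t) p (x := y) (by simpa)
    (by omega)
  -- D(n) = (y ⋏ (st)^n)(y ⋏ s^n)⁻¹. Both D(p) and D(1)^p are trivial, so the p-th difference of D
  -- at 0 is trivial too.
  have hD := M _ _ _ hug (I _ _ hus)
  have hev := polySeq_eval_prime h.prime hX hXc hbot hexp hD
    (by simp only [pow_zero, cw_one_right, map_one, inv_one, mul_one])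
  have hD1 : cpr W l (cw y (s * t)) * (cpr W l (cw y s))⁻¹ ∈ shiftedFil W l (l - p + 1) 3 := by
    rw [← map_inv, ← map_mul]
    refine Subgroup.mem_map_of_mem _ ?_
    have e : cw y (s * t) * (cw y s)⁻¹ =
        cw y t * (cw y s * ((cw y s)⁻¹ * cact t (cw y s)) * (cw y s)⁻¹) := by
      rw [cw_mul_right]
      group
    rw [e]
    refine mul_mem (mem_cfil_of_ckap_mem hN (by omega) ?_) ((cfil_normal _).conj_mem _ ?_ _)
    · rw [ckap_cw]
      have := hc (l - p) (by omega) (by omega)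
      rwa [show l - p + 2 = l - p + 1 + (3 - 2) by omega] at this
    · exact inv_mul_cact_mem (cw_mem_cfil hy s) t
  simp only [pow_one] at hev
  rw [hexp _ hD1, one_mul, iterate_sdiff1_mul hX hXc le_rfl hug (I _ _ hus) hbot',
    cpr_cw_eq_one (by omega) (by omega) (by omega) hy hsp,
    cpr_cw_eq_one (by omega) (by omega) (by omega) hy hgp, inv_one, mul_one] at hev
  -- Applied to the constant product u · u⁻¹, this identifies the p-th difference of u⁻¹. The two
  -- p-th differences then agree: e_{l-1} ⋏ st and e_{l-1} ⋏ s.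
  have hcancel := iterate_sdiff1_mul hX hXc le_rfl hus (I _ _ hus) hbot' 0
  have hone : sdiff1^[p] (fun _ : ℕ => (1 : CurlySquare G ⧸ cfil W (l + 1))) 0 = 1 :=
    iterate_sdiff1_zero fun _ _ => rfl
  simp only [mul_inv_cancel] at hcancel
  rw [hone] at hcancel
  have hfin := mul_right_cancel (hev.symm.trans hcancel)
  rw [iterate_sdiff1_cw_pow_zero l _ (by omega), iterate_sdiff1_cw_pow_zero l _ (by omega)] at hfin
  have hiter : ∀ i, i < p → (fun z => gc z s)^[i] y = lnc s t (l - p + i) ∧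
      (lnc s t (l - p + i))⁻¹ * (fun z => gc z (s * t))^[i] y ∈ lcs G (l - p + i + 1) := by
    intro i
    induction i with
    | zero => exact fun _ => ⟨rfl, by
        rw [Function.iterate_zero_apply, add_zero, ← hydef, inv_mul_cancel]; exact one_mem _⟩
    | succ i ih =>
      intro hi
      obtain ⟨h3, h4⟩ := ih (by omega)
      have h5 : lnc s t (l - p + (i + 1)) = gc (lnc s t (l - p + i)) s :=
        lnc_succ s t (i := l - p + i) (by omega)
      refine ⟨by rw [Function.iterate_succ_apply', h3, h5], ?_⟩
      rw [Function.iterate_succ_apply', h5]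
      exact gc_mul_congr (i := l - p + i) (by omega) (lnc_mem_lcs s t (by omega)) h4
        (hc (l - p + i) (by omega) (by omega))
  obtain ⟨h3, h4⟩ := hiter (p - 1) (by omega)
  rw [show l - p + (p - 1) = l - 1 by omega] at h3 h4
  have hel := lnc_mem_lcs s t (show 1 ≤ l - 1 by omega)
  rw [h3, cpr_cw_congr_left (by omega) le_rfl (by omega) hel h4 (mem_lcs_one _),
    cpr_cw_mul_right (by omega) le_rfl (by omega) hel (mem_lcs_one s)] at hfin
  exact cpr_eq_one_iff.1 (mul_eq_left.1 hfin)

end MaxClassSeries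

end PowerStep

/-! ### The induction along the levels and the choice of generators -/

section Induction

variable {G : Type*} [Group G] {W : Subgroup (BogomolovMultiplier G)}

/-- `[γ_i, γ_k] ≤ γ_{i+k+1}` on the left normed commutators, for `i + k < l`. -/
def DegreeBelow (s t : G) (l : ℕ) : Prop :=
  ∀ i k, 1 ≤ i → 1 ≤ k → i + k < l → gc (lnc s t i) (lnc s t k) ∈ lcs G (i + k + 1)

/-- Jacobi for e_i, e_k, s, where [e_i, e_k] ⋏ s drops out because [e_i, e_k] is one level too deep.
-/
theorem DegreeBelow.cpr_swap {s t : G} {l : ℕ} (hA : DegreeBelow s t l) {i k : ℕ} (hi : 1 ≤ i)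
    (hk : 1 ≤ k) (hik : i + k + 1 = l) :
    cpr W l (cw (lnc s t (i + 1)) (lnc s t k)) =
      (cpr W l (cw (lnc s t i) (lnc s t (k + 1))))⁻¹ := by
  have hJ := cpr_jacobi (W := W) hi hk le_rfl hik.symm (lnc_mem_lcs s t hi) (lnc_mem_lcs s t hk)
    (mem_lcs_one s)
  rwa [← lnc_succ s t hi, ← lnc_succ s t hk,
    cpr_cw_eq_one (by omega) le_rfl (by omega) (hA i k hi hk (by omega)) (mem_lcs_one s), mul_one,
    cpr_cw_swap (lnc s t i)] at hJ

theorem DegreeBelow.cpr_eq_zpow {s t : G} {l : ℕ} (hA : DegreeBelow s t l) {i k : ℕ} (hi : 1 ≤ i)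
    (hk : 1 ≤ k) (hik : i + k = l) :
    cpr W l (cw (lnc s t i) (lnc s t k)) =
      cpr W l (cw t (lnc s t (l - 1))) ^ ((-1 : ℤ) ^ (i + 1)) := by
  induction i, hi using Nat.le_induction generalizing k with
  | base =>
    rw [show l - 1 = k by omega, lnc_one]
    norm_num
  | succ i hi ih =>
    rw [hA.cpr_swap hi hk (by omega), ih (by omega) (by omega), ← zpow_neg, pow_succ _ (i + 1)]
    congr 1
    ring

theorem DegreeBelow.succ {s t : G} {l : ℕ} (hA : DegreeBelow s t l)
    (hF : cw (lnc s t (l - 1)) t ∈ cfil W (l + 1)) : DegreeBelow s t (l + 1) := by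
  intro i k hi hk hik
  obtain hik | hik : i + k < l ∨ i + k = l := by omega
  · exact hA i k hi hk hik
  · have h1 := hA.cpr_eq_zpow (W := W) hi hk hik
    rw [cpr_cw_swap (lnc s t (l - 1)), cpr_eq_one_iff.2 hF, inv_one, one_zpow, cpr_eq_one_iff] at h1
    have := ckap_mem_lcs h1
    rwa [ckap_cw, ← hik] at this

theorem DegreeBelow.cw_mem_of_even {s t : G} {l : ℕ} (hl : 2 ≤ l) (hA : DegreeBelow s t l)
    (he : Even l) : cw (lnc s t (l - 1)) t ∈ cfil W (l + 1) := by
  obtain ⟨m, rfl⟩ := he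
  have h1 := hA.cpr_eq_zpow (W := W) (show 1 ≤ m by omega) (show 1 ≤ m by omega) rfl
  rw [cw_self, map_one] at h1
  rw [← cpr_eq_one_iff, cpr_cw_swap, inv_eq_one]
  rcases neg_one_pow_eq_or ℤ (m + 1) with h2 | h2
  · rw [h2, zpow_one] at h1
    exact h1.symm
  · rw [h2, zpow_neg_one] at h1
    exact (inv_eq_one.1 h1.symm)

namespace MaxClassSeries

variable {p n : ℕ} (h : MaxClassSeries p n G)
include h

/-- Otherwise c = [t, e_{l-1}] generates γ_l/γ_{l+1}, and Jacobi expresses all e_i ⋏ e_{l+1-i}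
through c ⋏ s. The middle symbol is trivial, which forces p to divide (l - 1)/2, impossible for l ≤
p. -/
theorem gc_lnc_mem_of_le {s t : G} (hst : GenPair s t) {l : ℕ} (hl : 5 ≤ l) (hlp : l ≤ p)
    (hodd : Odd l) (hln : l + 1 < n) (hA : DegreeBelow s t l) :
    gc (lnc s t (l - 1)) t ∈ lcs G (l + 1) := by
  by_contra hcon
  set c := gc t (lnc s t (l - 1)) with hcdef
  have hcinv : gc (lnc s t (l - 1)) t = c⁻¹ := (gc_inv _ _).symm
  have hcl : c ∈ lcs G l := by
    have h1 := gc_mem_lcs (lnc_mem_lcs s t (show 1 ≤ l - 1 by omega)) t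
    rwa [hcinv, inv_mem_iff, Nat.sub_add_cancel (by omega)] at h1
  have hcl' : c ∉ lcs G (l + 1) := by rwa [hcinv, inv_mem_iff] at hcon
  have hcong : ∀ i k, 1 ≤ i → 1 ≤ k → i + k = l →
      (c ^ ((-1 : ℤ) ^ (i + 1)))⁻¹ * gc (lnc s t i) (lnc s t k) ∈ lcs G (l + 1) := by
    intro i k hi hk hik
    have h1 := hA.cpr_eq_zpow (W := ⊥) hi hk hik
    rw [← map_zpow] at h1
    have h2 := ckap_of_cpr_eq h1.symm
    rwa [map_zpow, ckap_cw, ckap_cw] at h2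
  have hval : ∀ i k, 1 ≤ i → 1 ≤ k → i + k = l → ∀ g,
      cpr (⊥ : Subgroup (BogomolovMultiplier G)) (l + 1) (cw (gc (lnc s t i) (lnc s t k)) g) =
        cpr ⊥ (l + 1) (cw c g) ^ ((-1 : ℤ) ^ (i + 1)) := by
    intro i k hi hk hik g
    rw [cpr_cw_congr_left (by omega) le_rfl le_rfl (zpow_mem hcl _) (hcong i k hi hk hik)
      (mem_lcs_one g), cpr_cw_zpow_left (by omega) le_rfl le_rfl hcl (mem_lcs_one g)]
  -- Jacobi for e_2, e_{l-2}, t: both terms other than [e_2, e_{l-2}] ⋏ t are too deep, and [e_2,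
  -- e_{l-2}] ≡ c⁻¹.
  have hct : cpr (⊥ : Subgroup (BogomolovMultiplier G)) (l + 1) (cw c t) = 1 := by
    have h1 : gc (lnc s t 2) t ∈ lcs G 4 := hA 2 1 (by omega) le_rfl (by omega)
    have h2 : gc (lnc s t (l - 2)) t ∈ lcs G l := by
      have := hA (l - 2) 1 (by omega) le_rfl (by omega)
      rwa [show l - 2 + 1 + 1 = l by omega] at this
    have hJ := cpr_jacobi (W := (⊥ : Subgroup (BogomolovMultiplier G))) (i := 2) (j := l - 2)
      (k := 1) (m := l + 1) (by omega) (by omega) le_rfl (by omega)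
      (lnc_mem_lcs s t (by omega)) (lnc_mem_lcs s t (by omega)) (mem_lcs_one t)
    rw [cpr_cw_eq_one (i := 4) (by omega) (show 1 ≤ l - 2 by omega) (by omega) h1
        (lnc_mem_lcs s t (by omega)),
      cpr_cw_eq_one (i := l) (by omega) (show 1 ≤ 2 by omega) (by omega) h2
        (lnc_mem_lcs s t (by omega)),
      one_mul, hval 2 (l - 2) (by omega) (by omega) (by omega)] at hJ
    norm_num at hJ
    exact hJ
  have hct' : gc c t ∈ lcs G (l + 2) := by
    rw [← ckap_cw]
    exact ckap_mem_lcs (cpr_eq_one_iff.1 hct)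
  have hcs := h.gc_s_notMem hst (by omega) hln hcl hcl' hct'
  have hd1 : cpr (⊥ : Subgroup (BogomolovMultiplier G)) (l + 1) (cw t (lnc s t l)) = 1 := by
    obtain ⟨k, hk⟩ := h.cyclic l (by omega) c hcl hcl' (lnc s t l) (lnc_mem_lcs s t (by omega))
    rw [cpr_cw_swap, cpr_cw_congr_left (by omega) le_rfl le_rfl (zpow_mem hcl k) hk (mem_lcs_one t),
      cpr_cw_zpow_left (by omega) le_rfl le_rfl hcl (mem_lcs_one t), hct, one_zpow, inv_one]
  have hd : ∀ i k, 1 ≤ i → 1 ≤ k → i + k = l + 1 →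
      cpr (⊥ : Subgroup (BogomolovMultiplier G)) (l + 1) (cw (lnc s t i) (lnc s t k)) =
        cpr ⊥ (l + 1) (cw c s) ^ ((-1 : ℤ) ^ i * (i - 1)) := by
    intro i k hi
    induction i, hi using Nat.le_induction generalizing k with
    | base =>
      intro _ hik
      obtain rfl : k = l := by omega
      rw [lnc_one, hd1]
      simp
    | succ i hi ih =>
      intro hk hik
      have hJ := cpr_jacobi (W := (⊥ : Subgroup (BogomolovMultiplier G))) (m := l + 1) hi hk le_rfl
        (by omega) (lnc_mem_lcs s t hi) (lnc_mem_lcs s t hk) (mem_lcs_one s)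
      rw [← lnc_succ s t hi, ← lnc_succ s t hk, cpr_cw_swap (lnc s t i),
        ih (k + 1) (by omega) (by omega), hval i k hi hk (by omega), ← zpow_neg, ← zpow_add] at hJ
      rw [hJ]
      congr 1
      push_cast
      ring
  -- With l = 2m + 1 the middle index is i = m + 1, where the exponent is ±m.
  obtain ⟨m, hm⟩ := hodd
  have h1 := hd (m + 1) (m + 1) (by omega) (by omega) (by omega)
  rw [cw_self, map_one, ← map_zpow] at h1
  have h2 := ckap_of_cpr_eq h1
  rw [map_one, inv_one, one_mul, map_zpow, ckap_cw] at h2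
  have h3 := dvd_of_zpow_mem h.prime (h.pow_mem (l + 1) (by omega) _ (gc_mem_lcs hcl s)) hcs h2
  rw [(isUnit_neg_one.pow _).dvd_mul_left] at h3
  have h4 := Int.le_of_dvd (by push_cast; omega) h3
  push_cast at h4
  omega

theorem exists_base_pair (hn : 3 ≤ n) :
    ∃ s t : G, GenPair s t ∧ gc (lnc s t 2) t ∈ lcs G 4 := by
  obtain ⟨x, hx, hx'⟩ := h.exists_gen (i := 2) (by omega) (by omega)
  obtain ⟨s, t, hst, hxt⟩ := h.exists_genPair_centralizing le_rfl hx
  refine ⟨s, t, hst, ?_⟩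
  obtain ⟨k, hk⟩ := h.cyclic 2 le_rfl x hx hx' (lnc s t 2) (lnc_mem_lcs s t (by omega))
  refine gc_mem_of_congr (by omega) (zpow_mem hx k) hk ?_
  have h1 := cpr_cw_zpow_left (W := ⊥) (show 1 ≤ 2 by omega) le_rfl (le_refl 3) hx
    (mem_lcs_one t) k
  rw [← map_zpow] at h1
  have h2 := ckap_of_cpr_eq h1.symm
  rw [map_zpow, ckap_cw, ckap_cw] at h2
  have h3 := mul_mem (zpow_mem hxt k) h2
  rwa [mul_inv_cancel_left] at h3

/-- The pair s, t is fixed once; `DegreeBelow` travels along with B₀(G) ≤ R_l since each free level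
needs the commutator relations below it. -/
theorem ker_le_cfil (hn : 3 ≤ n)
    (hW : ∀ l, 3 ≤ l → l < n → l ≤ p → Odd l → (ckap (G := G)).ker ≤ cfil W l →
      (ckap (G := G)).ker ≤ cfil W (l + 1)) : (ckap (G := G)).ker ≤ cfil W n := by
  obtain ⟨s, t, hst, hbase⟩ := h.exists_base_pair hn
  have hp := h.prime.two_le
  suffices H : ∀ l, 3 ≤ l → l ≤ n →
      (ckap (G := G)).ker ≤ cfil W l ∧ (l < n → DegreeBelow s t l) from (H n hn le_rfl).1
  intro l hl
  induction l, hl using Nat.le_induction with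
  | base =>
    refine fun _ => ⟨h.ker_le_three hst hn, fun _ i k hi hk hik => ?_⟩
    obtain ⟨rfl, rfl⟩ : i = 1 ∧ k = 1 := by omega
    rw [gc_eq_one_iff.2 (Commute.refl _)]
    exact one_mem _
  | succ l hl ih =>
    intro hln
    obtain ⟨hN, hA⟩ := ih (by omega)
    have hA := hA (by omega)
    have hc : ∀ i, 1 ≤ i → i + 1 < l → gc (lnc s t i) t ∈ lcs G (i + 2) := fun i hi hil =>
      hA i 1 hi le_rfl hil
    have hF : cw (lnc s t (l - 1)) t ∈ cfil W (l + 1) →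
        (ckap (G := G)).ker ≤ cfil W (l + 1) ∧ (l + 1 < n → DegreeBelow s t (l + 1)) := by
      intro hF
      refine ⟨?_, fun _ => hA.succ hF⟩
      have hgen := h.lnc_notMem hst hn (m := l - 1) (fun i hi him => hc i (by omega) (by omega))
        (i := l - 1) (by omega) le_rfl (by omega)
      obtain ⟨m, rfl⟩ : ∃ m, l = m + 1 := ⟨l - 1, by omega⟩
      exact h.ker_le_succ_of_cw_mem hst (by omega) (by omega) (lnc_mem_lcs s t (by omega)) hgen hF
        hN
    by_cases he : Even l
    · exact hF (hA.cw_mem_of_even (by omega) he)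
    have hodd : Odd l := Nat.not_even_iff_odd.1 he
    by_cases hlp : l ≤ p
    · have hN' := hW l hl (by omega) hlp hodd hN
      by_cases hln' : l + 1 < n
      -- After W has absorbed the level, a relation in γ_{l+1} lifts to R_{l+1}, so [e_{l-1}, t] ∈
      -- γ_{l+1} suffices.
      · refine hF (mem_cfil_of_ckap_mem hN' le_rfl ?_)
        rw [ckap_cw]
        obtain rfl | hl5 : l = 3 ∨ 5 ≤ l := by
          obtain ⟨m, hm⟩ := hodd
          omega
        · exact hbase
        · exact h.gc_lnc_mem_of_le hst hl5 hlp hodd hln' hA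
      · exact ⟨hN', fun hln'' => absurd hln'' hln'⟩
    · refine hF (h.cw_lnc_mem_of_lt hst hl (by omega) ?_ hN hbase hc)
      rcases h.prime.eq_two_or_odd' with hp2 | hp2
      · exact Or.inr hp2
      · obtain ⟨a, ha⟩ := hodd
        obtain ⟨b, hb⟩ := hp2
        omega

end MaxClassSeries

/-- If `γ_n(G) = 1`, the `n`-th term of the filtration is `W`. -/
theorem ker_le_of_ker_le_cfil {n : ℕ} (hn : 2 ≤ n) (hbot : lcs G n = ⊥)
    (hN : (ckap (G := G)).ker ≤ cfil W n) : W = ⊤ := by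
  rw [eq_top_iff]
  intro w _
  have h1 : cfil W n ≤ W.map (BogomolovMultiplier G).subtype := by
    refine cfil_le (fun x hx g => ?_) fun w hw => Subgroup.mem_map_of_mem _ hw
    have h2 := gc_mem_lcs hx g
    rw [Nat.sub_add_cancel (by omega), hbot, Subgroup.mem_bot, gc_eq_one_iff] at h2
    rw [cw_of_commute h2]
    exact one_mem _
  obtain ⟨v, hv, hvw⟩ := h1 (hN (MonoidHom.mem_ker.2 (ckap_coe w)))
  rwa [← Subtype.ext hvw]

theorem IsPGroupOfMaximalClass.exists_generators {p : ℕ} (hp : p.Prime)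
    (hG : IsPGroupOfMaximalClass p G) :
    ∃ f : ℕ → BogomolovMultiplier G, Subgroup.closure (f '' Set.Iio ((p - 1) / 2)) = ⊤ := by
  obtain ⟨n, hcard, hnil, hcl⟩ := hG
  have hbot : lcs G n = ⊥ := by
    rw [lcs, Subgroup.lowerCentralSeries_eq_bot_iff_nilpotencyClass_le]
    omega
  by_cases hn : n ≤ 2
  · exact ⟨fun _ => 1, ker_le_of_ker_le_cfil le_rfl (le_bot_iff.1 (hbot ▸ lcs_antitone hn))
      (by rw [cfil_eq_top le_rfl]; exact le_top)⟩
  · have h := IsPGroupOfMaximalClass.maxClassSeries hp (by omega) hcard hnil hcl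
    -- The j-th generator serves the odd level 2j + 3; beyond the class it is the dummy value 1. The
    -- condition 2j + 3 ≤ p gives j < (p - 1)/2.
    have hw : ∀ j : ℕ, ∃ w : BogomolovMultiplier G, 2 * j + 3 < n → ∀ W, w ∈ W →
        (ckap (G := G)).ker ≤ cfil W (2 * j + 3) → (ckap (G := G)).ker ≤ cfil W (2 * j + 4) := by
      intro j
      by_cases hj : 2 * j + 3 < n
      · obtain ⟨w, hw⟩ := h.exists_step_element (l := 2 * j + 2) (by omega) hj
        exact ⟨w, fun _ => hw⟩
      · exact ⟨1, fun hj' => absurd hj' hj⟩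
    choose f hf using hw
    refine ⟨f, ker_le_of_ker_le_cfil (by omega) hbot (h.ker_le_cfil (by omega) ?_)⟩
    rintro l hl hln hlp ⟨m, rfl⟩
    obtain ⟨j, rfl⟩ : ∃ j, m = j + 1 := ⟨m - 1, by omega⟩
    refine hf j hln _ (Subgroup.subset_closure ⟨j, ?_, rfl⟩)
    rw [Set.mem_Iio]
    omega

end Induction

theorem corollaryc (p : ℕ) (hp : p.Prime) (G : Type*) [Group G]
    (hG : IsPGroupOfMaximalClass p G) :
    ∃ _ : Group.FG (BogomolovMultiplier G),
      (Group.rank (BogomolovMultiplier G) : ℚ) ≤ ((p : ℚ) - 1) / 2 := by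
  classical
  obtain ⟨f, hf⟩ := hG.exists_generators hp
  have hS : Subgroup.closure
      (((Finset.range ((p - 1) / 2)).image f : Finset (BogomolovMultiplier G)) :
        Set (BogomolovMultiplier G)) = ⊤ := by
    rw [Finset.coe_image, Finset.coe_range]
    exact hf
  have hfg : Group.FG (BogomolovMultiplier G) := ⟨⟨_, hS⟩⟩
  refine ⟨hfg, ?_⟩
  have h1 : Group.rank (BogomolovMultiplier G) ≤ (p - 1) / 2 :=
    (Group.rank_le hS).trans (Finset.card_image_le.trans (Finset.card_range _).le)
  -- The division (p - 1)/2 is rounded down, so p = 2 gives rank 0.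
  have h2 : 2 * Group.rank (BogomolovMultiplier G) + 1 ≤ p := by
    have := hp.two_le
    omega
  have h3 : 2 * (Group.rank (BogomolovMultiplier G) : ℚ) + 1 ≤ p := by exact_mod_cast h2
  linarith
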